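/- Let $K$ be a field of characteristic zero and let $R$ be a commutative $K$-algebra. For a finite-dimensional commutative $K$-algebra $\mathcal D$ that is a product of local algebras with residue field $K$, a $\mathcal D$-ring is a $K$-algebra $A$ with a $K$-algebra homomorphism $e\colon A\to A\otimes_K\mathcal D$. For a basis $\epsilon_0,\dots,\epsilon_m$ of $\mathcal D$, its coordinate maps $\delta_i$ are given by $e(a)=\sum_i\delta_i(a)\otimes\epsilon_i$. It is a $\mathcal D^*$-ring if the $\delta_i$ commute pairwise. Its associated endomorphisms are the maps $(\mathrm{id}\otimes\pi)\circ e$ for $K$-algebra homomorphisms $\pi\colon\mathcal D\to K$. They are assumed to be injective. An ideal $I$ of $A$ is a $\mathcal D$-ideal if $\delta_i(I)\subseteq I$ for all $i$. A $\mathcal D$-ideal is perfect if it is radical and $a\,\sigma'(a)\in I$ implies $a\in I$ for every associated endomorphism $\sigma'$ and every $a \in A$. The $\mathcal D^*$-polynomial ring $A\{\bar x\}_{\mathcal D^*}$ in $\bar x=(x_i)_{i\in\mathcal I}$ is the polynomial ring over $A$ in indeterminates $d^\theta x_i$ ($i\in\mathcal I$, $\theta\in\mathbb N^{m+1}$), with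 the $\mathcal D$-structure that extends $e$ and sends $d^\theta x_i$ to $\sum_j d^{\theta+1_j}x_i\otimes\epsilon_j$. Below, $\bar x=(x_i)_{i\in\mathcal I}$ is a finite family of indeterminates. (1) Differential case. Let $\mathcal D=K[\epsilon]/(\epsilon)^2$ with basis $1,\epsilon$ and coordinate maps $\sigma,\delta$. The $\mathcal D^*$-ring structures $e$ on $R$ with $\sigma=\mathrm{id}$ are exactly the maps $e(r)=r\otimes1+\delta(r)\otimes\epsilon$ with $\delta$ a $K$-linear derivation of $R$. For each such $\delta$, let $R\{\bar x\}_\delta=R[\delta^kx_i : i\in\mathcal I,\ k\in\mathbb N]$ be the differential polynomial ring, with the $\mathcal D$-structure given by its derivation in the same way. Then: (a) $R\{\bar x\}_\delta$ is a $\mathcal D^*$-algebra over $(R,e)$ (with injective associated endomorphisms), and there is a surjective homomorphism of $(R,e)$-algebras $R\{\bar x\}_{\mathcal D^*}\to R\{\bar x\}_\delta$ with $d^{(\theta_0,\theta_1)}x_i\mapsto\delta^{\theta_1}x_i$; (b) in $R$ and in $R\{\bar x\}_\delta$, the perfect $\mathcal D$-ideals are exactly the radical differential ideals; (c) if $R$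 has the ascending chain condition on perfect $\mathcal D$-ideals, then so does $R\{\bar x\}_\delta$; that is, if $R$ has the ascending chain condition on radical differential ideals, then so does $R\{\bar x\}_\delta$. (2) Difference-differential case. Let $\mathcal D=K[\nu]/(\nu)^2\times K$ with basis $(1,0),(\nu,0),(0,1)$ and coordinate maps $\sigma_0,\delta,\sigma$. The $\mathcal D^*$-ring structures $e$ on $R$ with injective associated endomorphisms and $\sigma_0=\mathrm{id}$ are exactly the maps $e(r)=r\otimes(1,0)+\delta(r)\otimes(\nu,0)+\sigma(r)\otimes(0,1)$ with $\delta$ a $K$-linear derivation of $R$ and $\sigma$ an injective $K$-algebra endomorphism of $R$ that commutes with $\delta$. For each such $(\delta,\sigma)$, let $R\{\bar x\}_{\sigma,\delta}=R[\delta^k\sigma^lx_i : i\in\mathcal I,\ k,l\in\mathbb N]$ be the difference-differential polynomial ring, with the $\mathcal D$-structure given by its derivation and endomorphism in the same way. A perfect difference-differential ideal is an ideal $I$ closed under $\delta$ and $\sigma$ such that $\sigma^{k_1}(a)^{n_1}\cdots\sigma^{k_r}(a)^{n_r}\in I$ with $r,k_j,n_j\in\mathbb N$ implies $a\in I$. Then: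 (a) $R\{\bar x\}_{\sigma,\delta}$ is a $\mathcal D^*$-algebra over $(R,e)$ with injective associated endomorphisms, and there is a surjective homomorphism of $(R,e)$-algebras $R\{\bar x\}_{\mathcal D^*}\to R\{\bar x\}_{\sigma,\delta}$ with $d^{(\theta_0,\theta_1,\theta_2)}x_i\mapsto\delta^{\theta_1}\sigma^{\theta_2}x_i$; (b) in $R$ and in $R\{\bar x\}_{\sigma,\delta}$, the perfect $\mathcal D$-ideals are exactly the perfect difference-differential ideals; (c) if $R$ has the ascending chain condition on perfect $\mathcal D$-ideals, then so does $R\{\bar x\}_{\sigma,\delta}$; that is, if $R$ has the ascending chain condition on perfect difference-differential ideals, then so does $R\{\bar x\}_{\sigma,\delta}$. -/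

import Mathlib

open scoped TensorProduct DualNumber

noncomputable section

namespace DRing

section General

universe uK uD uR uS

variable {K : Type uK} [Field K] {D : Type uD} [CommRing D] [Algebra K D]
variable {R : Type uR} [CommRing R] [Algebra K R] {S : Type uS} [CommRing S] [Algebra K S]

/-- The `i`-th coordinate map `δ_i` of `e : R → R ⊗ D` with respect to a basis `b` of `D`, so that
`e r = ∑ i, δ_i r ⊗ b i`. -/
def coord {m : ℕ} (b : Module.Basis (Fin m) K D) (e : R →ₐ[K] R ⊗[K] D) (i : Fin m) :
    R →ₗ[K] R :=
  (TensorProduct.rid K R).toLinearMap ∘ₗ LinearMap.lTensor R (b.coord i) ∘ₗ e.toLinearMap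

/-- The functor `D(-) = - ⊗ D` on morphisms: `D(φ) = φ ⊗ id`. -/
def mapD (D : Type uD) [CommRing D] [Algebra K D] (φ : R →ₐ[K] S) :
    R ⊗[K] D →ₐ[K] S ⊗[K] D :=
  Algebra.TensorProduct.map φ (AlgHom.id K D)

/-- The operators of the `D`-ring `(R, e)` commute: `(id ⊗ β) ∘ D(e) ∘ e = D(e) ∘ e`, where
`id ⊗ β : (R ⊗ D) ⊗ D → (R ⊗ D) ⊗ D` exchanges the two factors `D`. -/
def IsDStarRing (e : R →ₐ[K] R ⊗[K] D) : Prop :=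
  ∀ r : R, TensorProduct.rightComm K R D D (mapD D e (e r)) = mapD D e (e r)

/-- `φ : (R, e) → (S, f)` is a homomorphism of `D`-rings: `D(φ) ∘ e = f ∘ φ`. -/
def IsDHom (e : R →ₐ[K] R ⊗[K] D) (f : S →ₐ[K] S ⊗[K] D) (φ : R →ₐ[K] S) : Prop :=
  ∀ r : R, mapD D φ (e r) = f (φ r)

/-- The endomorphism `(id ⊗ π) ∘ e` of `R` attached to a `K`-algebra homomorphism `π : D → K`.
If `D` is a product of finite-dimensional local `K`-algebras with residue field `K`, the
homomorphisms `π` are exactly the compositions of the projection to a factor with its residue map,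
so these are the associated endomorphisms `σ_1, …, σ_t` of `(R, e)`. -/
def assocEndo (e : R →ₐ[K] R ⊗[K] D) (π : D →ₐ[K] K) : R →ₐ[K] R :=
  ((Algebra.TensorProduct.rid K K R).toAlgHom.comp
    (Algebra.TensorProduct.map (AlgHom.id K R) π)).comp e

/-- All associated endomorphisms of `(R, e)` are injective. -/
def AssocEndosInjective (e : R →ₐ[K] R ⊗[K] D) : Prop :=
  ∀ π : D →ₐ[K] K, Function.Injective (assocEndo e π)

/-- `D`-ideals: `e(I) ⊆ I ⊗ D`, the latter being the ideal of `R ⊗ D` generated by `I`. -/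
def IsDIdeal (e : R →ₐ[K] R ⊗[K] D) (I : Ideal R) : Prop :=
  ∀ a ∈ I, e a ∈ I.map (Algebra.TensorProduct.includeLeft : R →ₐ[K] R ⊗[K] D)

/-- Perfect `D`-ideals: reflexive radical `D`-ideals, where reflexive means that `a * σ_i a ∈ I`
implies `a ∈ I` for every associated endomorphism `σ_i`. -/
def IsPerfectDIdeal (e : R →ₐ[K] R ⊗[K] D) (I : Ideal R) : Prop :=
  IsDIdeal e I ∧ (∀ (π : D →ₐ[K] K) (a : R), a * assocEndo e π a ∈ I → a ∈ I) ∧ I.IsRadical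

/-- The ascending chain condition on the ideals of `R` with the property `P`. -/
def HasACC (P : Ideal R → Prop) : Prop :=
  ∀ I : ℕ →o Ideal R, (∀ n, P (I n)) → ∃ n, ∀ m, n ≤ m → I m = I n

/-- The ring underlying the `D*`-polynomial ring in `x_i`, `i ∈ ι`, with `dim D = m`: the
polynomial ring in the indeterminates `d^θ x_i`, `θ ∈ ℕ^m`. -/
abbrev DStarPoly (m : ℕ) (ι : Type*) (R : Type*) [CommRing R] : Type _ :=
  MvPolynomial (ι × (Fin m → ℕ)) R

/-- The `D`-structure of the `D*`-polynomial ring with respect to the basis `b`: it extends `e`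
and sends `d^θ x_i` to `∑ j, d^(θ + 1_j) x_i ⊗ b j`. -/
def polyStructure {m : ℕ} (b : Module.Basis (Fin m) K D) (ι : Type*) (e : R →ₐ[K] R ⊗[K] D) :
    DStarPoly m ι R →ₐ[K] DStarPoly m ι R ⊗[K] D :=
  MvPolynomial.aevalTower
    ((mapD D (IsScalarTower.toAlgHom K R (DStarPoly m ι R))).comp e)
    (fun v => ∑ j : Fin m, MvPolynomial.X (v.1, v.2 + Pi.single j 1) ⊗ₜ[K] b j)

end General

section Classical

universe uK uR uT

variable {K : Type uK} [Field K] {R : Type uR} [CommRing R] [Algebra K R]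

/-- Apply a derivation of `R` to the coefficients of a polynomial over `R`. -/
def mapCoeffs {T : Type uT} (d : Derivation K R R) (p : MvPolynomial T R) : MvPolynomial T R :=
  ∑ s ∈ p.support, MvPolynomial.monomial s (d (p.coeff s))

theorem coeff_mapCoeffs {T : Type uT} (d : Derivation K R R) (p : MvPolynomial T R)
    (s : T →₀ ℕ) : (mapCoeffs d p).coeff s = d (p.coeff s) := by
  classical
  rw [mapCoeffs, MvPolynomial.coeff_sum]
  simp only [MvPolynomial.coeff_monomial]
  rw [Finset.sum_ite_eq' p.support s]
  split_ifs with h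
  · rfl
  · rw [MvPolynomial.notMem_support_iff.mp h, map_zero]

/-- Coefficientwise application of a derivation of `R`, as a derivation of the polynomial ring. -/
def coeffDerivation (T : Type uT) (d : Derivation K R R) :
    Derivation K (MvPolynomial T R) (MvPolynomial T R) :=
  Derivation.mk'
    { toFun := mapCoeffs d
      map_add' := fun p q => by
        ext s
        simp [coeff_mapCoeffs]
      map_smul' := fun c p => by
        ext s
        simp [coeff_mapCoeffs] }
    (fun p q => by
      classical
      ext s
      simp only [LinearMap.coe_mk, AddHom.coe_mk, smul_eq_mul]
      rw [mul_comm q, coeff_mapCoeffs, MvPolynomial.coeff_add, MvPolynomial.coeff_mul,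
        MvPolynomial.coeff_mul, MvPolynomial.coeff_mul, map_sum, ← Finset.sum_add_distrib]
      refine Finset.sum_congr rfl fun x _ => ?_
      rw [coeff_mapCoeffs, coeff_mapCoeffs, Derivation.leibniz, smul_eq_mul, smul_eq_mul,
        mul_comm (d _)])

/-- The derivation of a polynomial ring over `R` that extends `d` and has the values `v` at the
indeterminates. -/
def extendDerivation {T : Type uT} (d : Derivation K R R) (v : T → MvPolynomial T R) :
    Derivation K (MvPolynomial T R) (MvPolynomial T R) :=
  coeffDerivation T d + (MvPolynomial.mkDerivation R v).restrictScalars K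

/-- The differential polynomial ring `R{x_i : i ∈ ι}_δ`, with indeterminates `δ^k x_i`. -/
abbrev DiffPoly (ι : Type*) (R : Type*) [CommRing R] : Type _ := MvPolynomial (ι × ℕ) R

/-- The derivation of `R{x}_δ`: it extends `d` and sends `δ^k x_i` to `δ^(k+1) x_i`. -/
def diffPolyDeriv (ι : Type*) (d : Derivation K R R) :
    Derivation K (DiffPoly ι R) (DiffPoly ι R) :=
  extendDerivation d fun v => MvPolynomial.X (v.1, v.2 + 1)

/-- The difference-differential polynomial ring `R{x_i : i ∈ ι}_{σ,δ}`, with indeterminates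
`δ^k σ^l x_i`, written `(i, k, l)`. -/
abbrev DiffDiffPoly (ι : Type*) (R : Type*) [CommRing R] : Type _ := MvPolynomial (ι × ℕ × ℕ) R

/-- The derivation of `R{x}_{σ,δ}`: it extends `d` and sends `δ^k σ^l x_i` to
`δ^(k+1) σ^l x_i`. -/
def diffDiffPolyDeriv (ι : Type*) (d : Derivation K R R) :
    Derivation K (DiffDiffPoly ι R) (DiffDiffPoly ι R) :=
  extendDerivation d fun v => MvPolynomial.X (v.1, v.2.1 + 1, v.2.2)

/-- The endomorphism of `R{x}_{σ,δ}`: it extends `s` and sends `δ^k σ^l x_i` to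
`δ^k σ^(l+1) x_i`. -/
def diffDiffPolyEndo (ι : Type*) (s : R →ₐ[K] R) : DiffDiffPoly ι R →ₐ[K] DiffDiffPoly ι R :=
  MvPolynomial.aevalTower ((IsScalarTower.toAlgHom K R (DiffDiffPoly ι R)).comp s)
    (fun v => MvPolynomial.X (v.1, v.2.1, v.2.2 + 1))

/-- Radical differential ideals of `(R, d)`. -/
def IsRadicalDiffIdeal (d : Derivation K R R) (I : Ideal R) : Prop :=
  (∀ a ∈ I, d a ∈ I) ∧ I.IsRadical

/-- Perfect difference-differential ideals of `(R, s, d)`: ideals closed under `d` and `s` such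
that `τ_1(a)^(n_1) ⋯ τ_r(a)^(n_r) ∈ I`, with the `τ_j` powers of `s`, implies `a ∈ I`. The
list consists of the pairs `(k_j, n_j)` with `τ_j = s^(k_j)`. -/
def IsPerfectDiffDiffIdeal (d : Derivation K R R) (s : R →ₐ[K] R) (I : Ideal R) : Prop :=
  (∀ a ∈ I, d a ∈ I) ∧ (∀ a ∈ I, s a ∈ I) ∧
    ∀ (a : R) (l : List (ℕ × ℕ)), (l.map fun p => (s^[p.1] a) ^ p.2).prod ∈ I → a ∈ I

end Classical

section Examples

universe uK uR

variable (K : Type uK) [Field K]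

/-- The basis `1, ε` of `K[ε]/(ε)^2`. -/
def basisEps : Module.Basis (Fin 2) K K[ε] :=
  Module.Basis.ofEquivFun
    { toFun := fun z => ![z.fst, z.snd]
      invFun := fun v => v 0 • (1 : K[ε]) + v 1 • ε
      map_add' := fun z w => by simp
      map_smul' := fun c z => by simp
      left_inv := fun z => by ext <;> simp
      right_inv := fun v => by ext i; fin_cases i <;> simp }

/-- The basis `(1, 0), (ν, 0), (0, 1)` of `K[ν]/(ν)^2 × K`. -/
def basisNu : Module.Basis (Fin 3) K (K[ε] × K) :=
  Module.Basis.ofEquivFun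
    { toFun := fun z => ![z.1.fst, z.1.snd, z.2]
      invFun := fun v => v 0 • ((1 : K[ε]), (0 : K)) + v 1 • ((ε : K[ε]), (0 : K)) +
        v 2 • ((0 : K[ε]), (1 : K))
      map_add' := fun z w => by simp
      map_smul' := fun c z => by simp
      left_inv := fun z => by ext <;> simp
      right_inv := fun v => by ext i; fin_cases i <;> simp }

variable {K} {R : Type uR} [CommRing R] [Algebra K R]

/-- A differential ring `(R, d)` as a `D`-ring for `D = K[ε]/(ε)^2`:
`e r = r ⊗ 1 + d r ⊗ ε`. -/
def diffStructure (d : Derivation K R R) : R →ₐ[K] R ⊗[K] K[ε] :=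
  AlgHom.ofLinearMap
    ((TensorProduct.mk K R K[ε]).flip 1 + (TensorProduct.mk K R K[ε]).flip ε ∘ₗ d.toLinearMap)
    (by simp [Algebra.TensorProduct.one_def])
    (fun x y => by
      simp only [LinearMap.add_apply, LinearMap.comp_apply, LinearMap.flip_apply,
        TensorProduct.mk_apply, Derivation.coeFn_coe,
        Derivation.leibniz, smul_eq_mul, add_mul, mul_add,
        Algebra.TensorProduct.tmul_mul_tmul, TensorProduct.add_tmul, one_mul, mul_one,
        DualNumber.eps_mul_eps, TensorProduct.tmul_zero, add_zero]
      rw [mul_comm y (d x), add_comm ((x * d y) ⊗ₜ[K] (ε : K[ε])), add_assoc])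

/-- A difference-differential ring `(R, s, d)` as a `D`-ring for `D = K[ν]/(ν)^2 × K`:
`e r = r ⊗ (1, 0) + d r ⊗ (ν, 0) + s r ⊗ (0, 1)`. -/
def diffDiffStructure (d : Derivation K R R) (s : R →ₐ[K] R) :
    R →ₐ[K] R ⊗[K] (K[ε] × K) :=
  AlgHom.ofLinearMap
    ((TensorProduct.mk K R (K[ε] × K)).flip (1, 0) +
      (TensorProduct.mk K R (K[ε] × K)).flip (ε, 0) ∘ₗ d.toLinearMap +
      (TensorProduct.mk K R (K[ε] × K)).flip (0, 1) ∘ₗ s.toLinearMap)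
    (by
      simp only [LinearMap.add_apply, LinearMap.comp_apply, LinearMap.flip_apply,
        TensorProduct.mk_apply, Derivation.coeFn_coe,
        Derivation.map_one_eq_zero, TensorProduct.zero_tmul, AlgHom.toLinearMap_apply, map_one,
        add_zero, ← TensorProduct.tmul_add, Prod.mk_add_mk, zero_add]
      rfl)
    (fun x y => by
      simp only [LinearMap.add_apply, LinearMap.comp_apply, LinearMap.flip_apply,
        TensorProduct.mk_apply, Derivation.coeFn_coe,
        AlgHom.toLinearMap_apply, map_mul,
        Derivation.leibniz, smul_eq_mul, add_mul, mul_add,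
        Algebra.TensorProduct.tmul_mul_tmul, TensorProduct.add_tmul, Prod.mk_mul_mk, one_mul,
        mul_one, mul_zero, zero_mul, Prod.mk_zero_zero,
        DualNumber.eps_mul_eps, TensorProduct.tmul_zero, add_zero, zero_add]
      rw [mul_comm y (d x)]
      abel)

end Examples

end DRing

end

/-! The dictionary between `D`-structures and classical operators is read off coordinates.
Multiplicativity of `e`, compared on the given basis, is the Leibniz rule for the `ε`-coordinate and
multiplicativity for the idempotent coordinate, and the associated endomorphisms are the identity
and, in the second case, `σ`. The quotient maps from the `D*`-polynomial ring forget the exponent of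
the trivial operator.

Both basis theorems are instances of one Ritt–Raudenbush type statement, `hasACC_extend`, for
`IsReflexive` ideals; the differential case is `σ = id`. If it failed, Zorn's lemma would give a
reflexive ideal `P` maximal among those that are not the closure of a finite set, and `P` is prime
because `{T} ∩ {U}` lies in the closure of the products `TU` (`inf_reflClosure_le`). Consider the
pairs (leader, degree) of elements of `P` whose initial and separant avoid `P`. By Dickson's lemma
finitely many such elements `f_t` dominate all the others. Let `H` be the product of their initials
and separants, so `H ∉ P`, and let `Q` be the closure of the `f_t` together with finitely many
generators of the constants of `P`.

The colon ideal `Q : H` is again reflexive and is saturated with respect to all `σ^l` of these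
initials and separants. Hence reduction by `σ^l δ^k f_t` (`le_of_exists_reduction`) proves `P ≤ Q :
H`, that is, `H * P ⊆ Q`. Since the closure of `P ∪ {H}` is finitely generated by maximality, this
makes `P` finitely generated as well (`isFinitelyClosed_of_mul_mem`), a contradiction. -/

noncomputable section

namespace DRing

/-! ### Reflexive radical ideals, their closures and finite generation. -/

section PerfectIdeals

variable {K : Type*} [Field K] {R : Type*} [CommRing R] [Algebra K R]

/-- Ideals closed under the derivation `d` and the endomorphism `s` that are radical and reflexive
in the sense that `a * s a ∈ I` implies `a ∈ I`. -/
structure IsReflexive (d : Derivation K R R) (s : R →ₐ[K] R) (I : Ideal R) : Prop where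
  deriv_mem : ∀ a ∈ I, d a ∈ I
  endo_mem : ∀ a ∈ I, s a ∈ I
  mem_of_mul_endo_mem : ∀ a, a * s a ∈ I → a ∈ I
  isRadical : I.IsRadical

variable {d : Derivation K R R} {s : R →ₐ[K] R}

theorem IsReflexive.mem_of_pow_mem {I : Ideal R} (hI : IsReflexive d s I) {a : R} (n : ℕ)
    (h : a ^ n ∈ I) : a ∈ I :=
  hI.isRadical ⟨n, h⟩

/-- For `b = ∏_{k ≤ n} σ^k(a)`, the element `b * σ(b)` is a multiple of `∏_{k ≤ n+1} σ^k(a)`, so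
reflexivity shortens the product by one factor at a time. -/
theorem IsReflexive.mem_of_prod_iterate_mem {I : Ideal R} (hI : IsReflexive d s I) {a : R} (n : ℕ)
    (h : ∏ k ∈ Finset.range (n + 1), s^[k] a ∈ I) : a ∈ I := by
  induction n with
  | zero => simpa using h
  | succ n ih =>
    refine ih (hI.mem_of_mul_endo_mem _ ?_)
    have e : s (∏ k ∈ Finset.range (n + 1), s^[k] a) =
        ∏ k ∈ Finset.range (n + 1), s^[k + 1] a := by
      rw [map_prod]
      exact Finset.prod_congr rfl fun k _ => (Function.iterate_succ_apply' s k a).symm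
    rw [e, Finset.prod_range_succ' (fun k => s^[k] a) n]
    rw [Finset.prod_range_succ'] at h
    rw [mul_assoc, mul_comm (s^[0] a)]
    exact I.mul_mem_left (∏ k ∈ Finset.range n, s^[k + 1] a) h

theorem isPerfectDiffDiffIdeal_iff {I : Ideal R} :
    IsPerfectDiffDiffIdeal d s I ↔ IsReflexive d s I := by
  constructor
  · rintro ⟨h1, h2, h3⟩
    refine ⟨h1, h2, fun a ha => h3 a [(0, 1), (1, 1)] (by simpa using ha), ?_⟩
    rintro a ⟨n, hn⟩
    exact h3 a [(0, n)] (by simpa using hn)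
  · intro h
    refine ⟨h.1, h.2, fun a l hl => ?_⟩
    -- Every monomial in the `σ^k(a)` divides a power of one product `∏_{k ≤ m} σ^k(a)`, which
    -- reduces the general condition to radicality and the previous lemma.
    have key : ∀ l : List (ℕ × ℕ), ∃ m n : ℕ, (l.map fun p => (s^[p.1] a) ^ p.2).prod ∣
        (∏ k ∈ Finset.range (m + 1), s^[k] a) ^ n := by
      intro l
      induction l with
      | nil => exact ⟨0, 0, by simp⟩
      | cons p l ih =>
        obtain ⟨m, n, hmn⟩ := ih
        refine ⟨max m p.1, p.2 + n, ?_⟩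
        rw [List.map_cons, List.prod_cons, pow_add]
        refine mul_dvd_mul (pow_dvd_pow_of_dvd (Finset.dvd_prod_of_mem _ (by simp)) _)
          (hmn.trans (pow_dvd_pow_of_dvd (Finset.prod_dvd_prod_of_subset _ _ _ ?_) _))
        exact Finset.range_subset_range.2 (by omega)
    obtain ⟨m, n, hmn⟩ := key l
    exact h.mem_of_prod_iterate_mem m (h.mem_of_pow_mem n (I.mem_of_dvd hmn hl))

theorem isRadicalDiffIdeal_iff {I : Ideal R} :
    IsRadicalDiffIdeal d I ↔ IsReflexive d (AlgHom.id K R) I :=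
  ⟨fun h => ⟨h.1, fun _ ha => ha, fun a ha => h.2 ⟨2, by rwa [pow_two]⟩, h.2⟩,
    fun h => ⟨h.1, h.4⟩⟩

/-- Each condition is tested on `t * _` after multiplying by a suitable factor. For the derivation,
`t * d a * d (t * a)` is `(t * d a) ^ 2` modulo `I`, so radicality applies; the two conditions on
`s` use reflexivity of `I`. Thus `T` itself need not be stable under the operators. -/
theorem IsReflexive.colon {I : Ideal R} (hI : IsReflexive d s I) (T : Set R) {J : Ideal R}
    (hJ : ∀ a, a ∈ J ↔ ∀ t ∈ T, t * a ∈ I) : IsReflexive d s J := by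
  refine ⟨fun a ha => (hJ _).2 fun t ht => ?_, fun a ha => (hJ _).2 fun t ht => ?_,
    fun a ha => (hJ _).2 fun t ht => ?_, ?_⟩
  · have h1 := (hJ a).1 ha t ht
    have h2 := hI.deriv_mem _ h1
    rw [Derivation.leibniz, smul_eq_mul, smul_eq_mul] at h2
    refine hI.mem_of_pow_mem 2 ?_
    have h3 := I.sub_mem (I.mul_mem_left (t * d a) h2) (I.mul_mem_left (d a * d t) h1)
    convert h3 using 1
    ring
  · have h2 := hI.endo_mem _ ((hJ a).1 ha t ht)
    refine hI.mem_of_mul_endo_mem _ ?_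
    have h3 := I.mul_mem_left (t * s (s a)) h2
    convert h3 using 1
    simp only [map_mul]
    ring
  · refine hI.mem_of_mul_endo_mem _ ?_
    have h3 := I.mul_mem_left (s t) ((hJ _).1 ha t ht)
    convert h3 using 1
    simp only [map_mul]
    ring
  · rintro a ⟨n, hn⟩
    refine (hJ _).2 fun t ht => hI.mem_of_pow_mem (n + 1) ?_
    have h3 := I.mul_mem_left (t ^ n * a) ((hJ _).1 hn t ht)
    convert h3 using 1
    ring

theorem IsReflexive.sInf {F : Set (Ideal R)} (hF : ∀ I ∈ F, IsReflexive d s I) :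
    IsReflexive d s (sInf F) := by
  refine ⟨fun a ha => ?_, fun a ha => ?_, fun a ha => ?_, ?_⟩
  · exact Submodule.mem_sInf.2 fun I hI => (hF I hI).deriv_mem a (Submodule.mem_sInf.1 ha I hI)
  · exact Submodule.mem_sInf.2 fun I hI => (hF I hI).endo_mem a (Submodule.mem_sInf.1 ha I hI)
  · exact Submodule.mem_sInf.2 fun I hI =>
      (hF I hI).mem_of_mul_endo_mem a (Submodule.mem_sInf.1 ha I hI)
  · rintro a ⟨n, hn⟩
    exact Submodule.mem_sInf.2 fun I hI =>
      (hF I hI).mem_of_pow_mem n (Submodule.mem_sInf.1 hn I hI)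

/-- Each closure condition has a single membership as its premise, so it passes to directed unions.
-/
theorem IsReflexive.sSup {F : Set (Ideal R)} (hF : ∀ I ∈ F, IsReflexive d s I)
    (hne : F.Nonempty) (hdir : DirectedOn (· ≤ ·) F) : IsReflexive d s (sSup F) := by
  have hm : ∀ a, a ∈ SupSet.sSup F ↔ ∃ I ∈ F, a ∈ I := fun a =>
    Submodule.mem_sSup_of_directed hne hdir
  refine ⟨fun a ha => ?_, fun a ha => ?_, fun a ha => ?_, ?_⟩
  · obtain ⟨I, hI, h⟩ := (hm _).1 ha
    exact (hm _).2 ⟨I, hI, (hF I hI).deriv_mem a h⟩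
  · obtain ⟨I, hI, h⟩ := (hm _).1 ha
    exact (hm _).2 ⟨I, hI, (hF I hI).endo_mem a h⟩
  · obtain ⟨I, hI, h⟩ := (hm _).1 ha
    exact (hm _).2 ⟨I, hI, (hF I hI).mem_of_mul_endo_mem a h⟩
  · rintro a ⟨n, hn⟩
    obtain ⟨I, hI, h⟩ := (hm _).1 hn
    exact (hm _).2 ⟨I, hI, (hF I hI).mem_of_pow_mem n h⟩

variable (d s) in
/-- The smallest reflexive radical ideal closed under `d` and `s` that contains `T`. -/
def reflClosure (T : Set R) : Ideal R :=
  sInf {I | IsReflexive d s I ∧ T ⊆ I}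

theorem isReflexive_reflClosure (T : Set R) : IsReflexive d s (reflClosure d s T) :=
  IsReflexive.sInf fun _ hI => hI.1

theorem subset_reflClosure (T : Set R) : T ⊆ reflClosure d s T := fun _ ha =>
  Submodule.mem_sInf.2 fun _ hI => hI.2 ha

theorem reflClosure_le {T : Set R} {I : Ideal R} (hI : IsReflexive d s I) (h : T ⊆ I) :
    reflClosure d s T ≤ I :=
  sInf_le ⟨hI, h⟩

theorem reflClosure_mono {T U : Set R} (h : T ⊆ U) : reflClosure d s T ≤ reflClosure d s U :=
  reflClosure_le (isReflexive_reflClosure U) (h.trans (subset_reflClosure U))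

/-- The ideal of all `a` with `T * a ⊆ I`. -/
def setColon (I : Ideal R) (T : Set R) : Ideal R where
  carrier := {a | ∀ t ∈ T, t * a ∈ I}
  add_mem' ha hb t ht := by
    rw [mul_add]
    exact I.add_mem (ha t ht) (hb t ht)
  zero_mem' t _ := by simp
  smul_mem' c a ha t ht := by
    rw [smul_eq_mul, mul_left_comm]
    exact I.mul_mem_left c (ha t ht)

theorem mem_setColon {I : Ideal R} {T : Set R} {a : R} :
    a ∈ setColon I T ↔ ∀ t ∈ T, t * a ∈ I :=
  Iff.rfl

theorem IsReflexive.setColon {I : Ideal R} (hI : IsReflexive d s I) (T : Set R) :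
    IsReflexive d s (setColon I T) :=
  hI.colon T fun _ => mem_setColon

/-- Taking colon ideals twice replaces first `U` and then `T` by its closure; an element of both
closures then has its square in `I`. -/
theorem inf_reflClosure_le {I : Ideal R} (hI : IsReflexive d s I) {T U : Set R}
    (h : ∀ t ∈ T, ∀ u ∈ U, t * u ∈ I) : reflClosure d s T ⊓ reflClosure d s U ≤ I := by
  have h1 : reflClosure d s U ≤ DRing.setColon I T :=
    reflClosure_le (hI.setColon T) fun u hu t ht => h t ht u hu
  have h2 : reflClosure d s T ≤ DRing.setColon I (reflClosure d s U) :=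
    reflClosure_le (hI.setColon _) fun t ht u hu => by
      rw [mul_comm]
      exact h1 hu t ht
  rintro a ⟨ha, ha'⟩
  refine hI.mem_of_pow_mem 2 ?_
  rw [pow_two]
  exact h2 ha a ha'

variable (d s) in
/-- `I` is the closure of a finite set. -/
def IsFinitelyClosed (I : Ideal R) : Prop :=
  ∃ F : Finset R, I = reflClosure d s F

/-- The closure of `T` is the directed union of the closures of finite subsets of `T`, and finitely
many generators already lie in one of these. -/
theorem exists_finset_subset_reflClosure_eq {T : Set R}
    (hT : IsFinitelyClosed d s (reflClosure d s T)) :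
    ∃ F : Finset R, (F : Set R) ⊆ T ∧ reflClosure d s F = reflClosure d s T := by
  classical
  let 𝓕 : Set (Ideal R) := {I | ∃ G : Finset R, (G : Set R) ⊆ T ∧ I = reflClosure d s G}
  have hne : 𝓕.Nonempty := ⟨_, ∅, by simp, rfl⟩
  have hdir : DirectedOn (· ≤ ·) 𝓕 := by
    rintro _ ⟨G, hG, rfl⟩ _ ⟨G', hG', rfl⟩
    refine ⟨_, ⟨G ∪ G', by simp [hG, hG'], rfl⟩, reflClosure_mono ?_, reflClosure_mono ?_⟩ <;> simp
  have hrefl : ∀ I ∈ 𝓕, IsReflexive d s I := by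
    rintro _ ⟨G, -, rfl⟩
    exact isReflexive_reflClosure _
  have hle : reflClosure d s T ≤ SupSet.sSup 𝓕 := by
    refine reflClosure_le (IsReflexive.sSup hrefl hne hdir) fun t ht => ?_
    refine (Submodule.mem_sSup_of_directed hne hdir).2
      ⟨_, ⟨{t}, by simpa using ht, rfl⟩, subset_reflClosure _ (by simp)⟩
  have hfin : ∀ F : Finset R, (F : Set R) ⊆ reflClosure d s T →
      ∃ G : Finset R, (G : Set R) ⊆ T ∧ (F : Set R) ⊆ reflClosure d s G := by
    intro F
    induction F using Finset.induction_on with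
    | empty => exact fun _ => ⟨∅, by simp, by simp⟩
    | insert a F _ ih =>
      intro h
      rw [Finset.coe_insert, Set.insert_subset_iff] at h
      obtain ⟨G, hG, hFG⟩ := ih h.2
      obtain ⟨_, ⟨G', hG', rfl⟩, ha⟩ := (Submodule.mem_sSup_of_directed hne hdir).1 (hle h.1)
      refine ⟨G ∪ G', by simp [hG, hG'], ?_⟩
      rw [Finset.coe_insert, Set.insert_subset_iff]
      exact ⟨reflClosure_mono (by simp) ha, hFG.trans (reflClosure_mono (by simp))⟩
  obtain ⟨F, hF⟩ := hT
  obtain ⟨G, hG, hFG⟩ := hfin F (by rw [hF]; exact subset_reflClosure _)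
  refine ⟨G, hG, le_antisymm (reflClosure_mono hG) ?_⟩
  rw [hF]
  exact reflClosure_le (isReflexive_reflClosure _) hFG

/-- A maximal closure of a finite subset of `I` must contain every element of `I`, since adjoining
one more element cannot enlarge it. -/
theorem HasACC.isFinitelyClosed (h : HasACC (IsReflexive d s)) {I : Ideal R}
    (hI : IsReflexive d s I) : IsFinitelyClosed d s I := by
  classical
  have hwf : WellFoundedGT {J : Ideal R // IsReflexive d s J} := by
    rw [wellFoundedGT_iff_monotone_chain_condition]
    intro f
    obtain ⟨n, hn⟩ := h ((OrderHom.Subtype.val _).comp f) fun n => (f n).2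
    exact ⟨n, fun m hm => Subtype.ext (hn m hm).symm⟩
  obtain ⟨⟨_, _⟩, ⟨F, hF, rfl⟩, hmax⟩ := hwf.wf.has_min
    {J : {J : Ideal R // IsReflexive d s J} |
      ∃ F : Finset R, (F : Set R) ⊆ I ∧ J.1 = reflClosure d s F}
    ⟨⟨_, isReflexive_reflClosure _⟩, ∅, by simp, rfl⟩
  refine ⟨F, le_antisymm (fun a ha => ?_) (reflClosure_le hI hF)⟩
  have hle : reflClosure d s (F : Set R) ≤ reflClosure d s (insert a F : Finset R) :=
    reflClosure_mono (by simp)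
  have hge := hmax ⟨_, isReflexive_reflClosure (insert a F : Finset R)⟩
    ⟨_, by simpa [Set.insert_subset_iff] using ⟨ha, hF⟩, rfl⟩
  by_contra hna
  refine hge (lt_of_le_of_ne hle fun he => hna ?_)
  have he' := Subtype.ext_iff.1 he
  change reflClosure d s (F : Set R) = reflClosure d s (insert a F : Finset R) at he'
  rw [he']
  exact subset_reflClosure _ (by simp)

theorem hasACC_of_isFinitelyClosed
    (h : ∀ I : Ideal R, IsReflexive d s I → IsFinitelyClosed d s I) :
    HasACC (IsReflexive d s) := by
  intro I hI
  have hdir : DirectedOn (· ≤ ·) (Set.range I) :=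
    (directedOn_range (r := (· ≤ ·))).2 I.monotone.directed_le
  have hU := IsReflexive.sSup (F := Set.range I) (by rintro _ ⟨n, rfl⟩; exact hI n)
    (Set.range_nonempty _) hdir
  obtain ⟨F, hF⟩ := h _ hU
  have hmem : ∀ G : Finset R, (G : Set R) ⊆ (SupSet.sSup (Set.range I) : Ideal R) →
      ∃ n, (G : Set R) ⊆ I n := by
    classical
    intro G
    induction G using Finset.induction_on with
    | empty => exact fun _ => ⟨0, by simp⟩
    | insert a G _ ih =>
      intro hG
      rw [Finset.coe_insert, Set.insert_subset_iff] at hG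
      obtain ⟨n, hn⟩ := ih hG.2
      obtain ⟨_, ⟨m, rfl⟩, hm⟩ :=
        (Submodule.mem_sSup_of_directed (Set.range_nonempty _) hdir).1 hG.1
      refine ⟨max n m, ?_⟩
      rw [Finset.coe_insert, Set.insert_subset_iff]
      exact ⟨I.monotone (le_max_right n m) hm, hn.trans (I.monotone (le_max_left n m))⟩
  obtain ⟨n, hn⟩ := hmem F (by rw [hF]; exact subset_reflClosure _)
  refine ⟨n, fun m hm => le_antisymm ?_ (I.monotone hm)⟩
  refine (le_sSup (Set.mem_range_self m)).trans ?_
  rw [hF]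
  exact reflClosure_le (hI n) hn

theorem exists_maximal_not_isFinitelyClosed {I : Ideal R} (hI : IsReflexive d s I)
    (hn : ¬ IsFinitelyClosed d s I) :
    ∃ P : Ideal R, IsReflexive d s P ∧ ¬ IsFinitelyClosed d s P ∧
      ∀ J : Ideal R, IsReflexive d s J → P < J → IsFinitelyClosed d s J := by
  have hub : ∀ c ⊆ {J : Ideal R | IsReflexive d s J ∧ ¬ IsFinitelyClosed d s J},
      IsChain (· ≤ ·) c → ∀ J ∈ c,
        ∃ ub ∈ {J : Ideal R | IsReflexive d s J ∧ ¬ IsFinitelyClosed d s J}, ∀ z ∈ c, z ≤ ub := by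
    intro c hc hchain J hJ
    have hdir : DirectedOn (· ≤ ·) c := hchain.directedOn
    have hU := IsReflexive.sSup (fun I hI => (hc hI).1) ⟨J, hJ⟩ hdir
    -- A finite generating set of the union would lie in one member of the chain, which would then
    -- be finitely closed.
    refine ⟨SupSet.sSup c, ⟨hU, fun hf => ?_⟩, fun _ h => le_sSup h⟩
    obtain ⟨F, hF⟩ := hf
    have hmem : ∀ G : Finset R, (G : Set R) ⊆ (SupSet.sSup c : Ideal R) →
        ∃ L ∈ c, (G : Set R) ⊆ L := by
      classical
      intro G
      induction G using Finset.induction_on with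
      | empty => exact fun _ => ⟨J, hJ, by simp⟩
      | insert a G _ ih =>
        intro hG
        rw [Finset.coe_insert, Set.insert_subset_iff] at hG
        obtain ⟨n, hnc, hn⟩ := ih hG.2
        obtain ⟨m, hmc, hm⟩ := (Submodule.mem_sSup_of_directed ⟨J, hJ⟩ hdir).1 hG.1
        obtain ⟨L, hLc, h1, h2⟩ := hdir n hnc m hmc
        refine ⟨L, hLc, ?_⟩
        rw [Finset.coe_insert, Set.insert_subset_iff]
        exact ⟨h2 hm, hn.trans h1⟩
    obtain ⟨L, hL, hFL⟩ := hmem F (by rw [hF]; exact subset_reflClosure _)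
    refine (hc hL).2 ⟨F, le_antisymm ?_ (reflClosure_le (hc hL).1 hFL)⟩
    rw [← hF]
    exact le_sSup hL
  obtain ⟨P, -, hP⟩ := zorn_le_nonempty₀ _ hub I ⟨hI, hn⟩
  refine ⟨P, hP.prop.1, hP.prop.2, fun J hJ hlt => ?_⟩
  by_contra hc
  exact hlt.not_ge (hP.le_of_ge ⟨hJ, hc⟩ hlt.le)

theorem exists_finset_insert {P : Ideal R}
    (hmax : ∀ J : Ideal R, IsReflexive d s J → P < J → IsFinitelyClosed d s J) {a : R}
    (ha : a ∉ P) :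
    ∃ F : Finset R, (F : Set R) ⊆ insert a (P : Set R) ∧ P ≤ reflClosure d s F := by
  have hlt : P < reflClosure d s (insert a (P : Set R)) := by
    refine lt_of_le_of_ne ?_ fun h => ha ?_
    · exact (Set.subset_insert _ _).trans (subset_reflClosure _)
    · rw [h]
      exact subset_reflClosure _ (Set.mem_insert _ _)
  obtain ⟨F, hF, he⟩ :=
    exists_finset_subset_reflClosure_eq (hmax _ (isReflexive_reflClosure _) hlt)
  exact ⟨F, hF, by rw [he]; exact hlt.le⟩

/-- If `a * b ∈ P` with `a, b ∉ P`, then `P` lies in the closures of finite sets `F ⊆ P ∪ {a}` and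
`G ⊆ P ∪ {b}`. The products `F * G` lie in `P`, and their closure contains the intersection, hence
`P`. -/
theorem isPrime_of_maximal_not_isFinitelyClosed {P : Ideal R} (hP : IsReflexive d s P)
    (hn : ¬ IsFinitelyClosed d s P)
    (hmax : ∀ J : Ideal R, IsReflexive d s J → P < J → IsFinitelyClosed d s J) : P.IsPrime := by
  classical
  refine ⟨fun h => hn ⟨{1}, ?_⟩, fun {a b} hab => ?_⟩
  · rw [h, eq_comm, Ideal.eq_top_iff_one]
    exact subset_reflClosure _ (by simp)
  · by_contra! hc
    obtain ⟨F, hF, hPF⟩ := exists_finset_insert hmax hc.1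
    obtain ⟨G, hG, hPG⟩ := exists_finset_insert hmax hc.2
    refine hn ⟨Finset.image₂ (· * ·) F G, le_antisymm ?_ (reflClosure_le hP ?_)⟩
    · refine (le_inf hPF hPG).trans (inf_reflClosure_le (isReflexive_reflClosure _) ?_)
      exact fun t ht u hu => subset_reflClosure _
        (Finset.mem_coe.2 (Finset.mem_image₂_of_mem ht hu))
    · intro x hx
      obtain ⟨t, ht, u, hu, rfl⟩ := Finset.mem_image₂.1 (Finset.mem_coe.1 hx)
      rcases hF ht with rfl | h1
      · rcases hG hu with rfl | h2
        · exact hab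
        · exact P.mul_mem_left _ h2
      · exact P.mul_mem_right _ h1

/-- Suppose that all reflexive ideals above `P` are finitely closed. Then `P` is finitely closed if
some multiple `h * P` with `h ∉ P` lies in the closure of a finite subset of `P`. -/
theorem isFinitelyClosed_of_mul_mem {P : Ideal R} (hP : IsReflexive d s P)
    (hmax : ∀ J : Ideal R, IsReflexive d s J → P < J → IsFinitelyClosed d s J) {h : R}
    (hh : h ∉ P) {F : Finset R} (hF : (F : Set R) ⊆ P)
    (hmul : ∀ a ∈ P, h * a ∈ reflClosure d s F) : IsFinitelyClosed d s P := by
  classical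
  obtain ⟨G, hG, hPG⟩ := exists_finset_insert hmax hh
  refine ⟨F ∪ G.erase h, le_antisymm ?_ (reflClosure_le hP ?_)⟩
  · have hle : P ≤ reflClosure d s (P : Set R) := subset_reflClosure _
    refine (le_inf hle hPG).trans (inf_reflClosure_le (isReflexive_reflClosure _) ?_)
    -- For `t ∈ P` and `u ∈ G`, the product is controlled by `hmul` when `u = h`; otherwise `u` is
    -- itself one of the new generators.
    intro t ht u hu
    by_cases huh : u = h
    · rw [huh, mul_comm]
      exact reflClosure_mono (by simp) (hmul t ht)
    · exact Ideal.mul_mem_left _ _ (subset_reflClosure _ (by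
        simp only [Finset.coe_union, Finset.coe_erase]
        exact Or.inr ⟨hu, huh⟩))
  · intro x hx
    simp only [Finset.coe_union, Finset.coe_erase] at hx
    rcases hx with hx | ⟨hx, hxh⟩
    · exact hF hx
    · exact (hG hx).resolve_left hxh

end PerfectIdeals

/-! ### Leaders, initials and separants of polynomials in ordered indeterminates. -/

section Leaders

open MvPolynomial

variable {V : Type*} [LinearOrder V] {R : Type*} [CommRing R]

variable (R) in
/-- The polynomials in the indeterminates below `v`. -/
abbrev lowerPoly (v : V) : Subalgebra R (MvPolynomial V R) :=
  supported R (Set.Iio v)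

variable (R) in
/-- The polynomials in the indeterminates up to `v` that have degree less than `n` in `v`. -/
def lowDegree (v : V) (n : ℕ) : Submodule R (MvPolynomial V R) :=
  Submodule.span R {f | ∃ a ∈ lowerPoly R v, ∃ i < n, f = a * X v ^ i}

theorem mul_X_pow_mem_lowDegree {v : V} {n i : ℕ} {a : MvPolynomial V R}
    (ha : a ∈ lowerPoly R v) (hi : i < n) : a * X v ^ i ∈ lowDegree R v n :=
  Submodule.subset_span ⟨a, ha, i, hi, rfl⟩

theorem lowDegree_induction {v : V} {n : ℕ} {p : MvPolynomial V R → Prop}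
    (hmono : ∀ a ∈ lowerPoly R v, ∀ i < n, p (a * X v ^ i)) (hzero : p 0)
    (hadd : ∀ f g, p f → p g → p (f + g)) {f : MvPolynomial V R} (hf : f ∈ lowDegree R v n) :
    p f := by
  -- The spanning set is stable under scalars, so quantifying over all multiples dispenses with a
  -- scalar case.
  have : ∀ r : R, p (r • f) := by
    refine Submodule.span_induction ?_ ?_ ?_ ?_ hf
    · rintro _ ⟨a, ha, i, hi, rfl⟩ r
      rw [← smul_mul_assoc]
      exact hmono _ (Subalgebra.smul_mem _ ha r) i hi
    · intro r
      rwa [smul_zero]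
    · intro f g _ _ hf hg r
      rw [smul_add]
      exact hadd _ _ (hf r) (hg r)
    · intro r f _ hf t
      rw [smul_smul]
      exact hf _
  simpa using this 1

theorem lowDegree_mono {v : V} {m n : ℕ} (h : m ≤ n) : lowDegree R v m ≤ lowDegree R v n :=
  Submodule.span_mono fun _ ⟨a, ha, i, hi, hf⟩ => ⟨a, ha, i, hi.trans_le h, hf⟩

theorem lowDegree_zero {v : V} {f : MvPolynomial V R} (hf : f ∈ lowDegree R v 0) : f = 0 :=
  lowDegree_induction (p := fun f => f = 0) (by simp) rfl (by rintro _ _ rfl rfl; simp) hf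

theorem mul_X_pow_mul_mem_lowDegree {v : V} {n j : ℕ} {a f : MvPolynomial V R}
    (ha : a ∈ lowerPoly R v) (hf : f ∈ lowDegree R v n) :
    a * X v ^ j * f ∈ lowDegree R v (j + n) := by
  refine lowDegree_induction (p := fun f => a * X v ^ j * f ∈ lowDegree R v (j + n)) ?_ ?_ ?_ hf
  · intro b hb i hi
    have : a * X v ^ j * (b * X v ^ i) = a * b * X v ^ (j + i) := by ring
    rw [this]
    exact mul_X_pow_mem_lowDegree (mul_mem ha hb) (by omega)
  · simp
  · intro f g hf hg
    rw [mul_add]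
    exact add_mem hf hg

theorem mul_mem_lowDegree {v : V} {n : ℕ} {a f : MvPolynomial V R}
    (ha : a ∈ lowerPoly R v) (hf : f ∈ lowDegree R v n) : a * f ∈ lowDegree R v n := by
  simpa using mul_X_pow_mul_mem_lowDegree (j := 0) ha hf

theorem mem_lowDegree_of_mem_lowerPoly {v : V} {n : ℕ} {a : MvPolynomial V R}
    (ha : a ∈ lowerPoly R v) (hn : 0 < n) : a ∈ lowDegree R v n := by
  simpa using mul_X_pow_mem_lowDegree (i := 0) ha hn

theorem exists_eq_of_mem_lowDegree_succ {v : V} {n : ℕ} {f : MvPolynomial V R}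
    (hf : f ∈ lowDegree R v (n + 1)) :
    ∃ a ∈ lowerPoly R v, ∃ g ∈ lowDegree R v n, f = a * X v ^ n + g := by
  refine lowDegree_induction
    (p := fun f => ∃ a ∈ lowerPoly R v, ∃ g ∈ lowDegree R v n, f = a * X v ^ n + g) ?_ ?_ ?_ hf
  · intro a ha i hi
    rcases Nat.lt_succ_iff_lt_or_eq.1 hi with h | rfl
    · exact ⟨0, zero_mem _, _, mul_X_pow_mem_lowDegree ha h, by simp⟩
    · exact ⟨a, ha, 0, zero_mem _, by simp⟩
  · exact ⟨0, zero_mem _, 0, zero_mem _, by simp⟩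
  · rintro _ _ ⟨a, ha, f, hf, rfl⟩ ⟨b, hb, g, hg, rfl⟩
    exact ⟨a + b, add_mem ha hb, f + g, add_mem hf hg, by ring⟩

theorem mem_lowDegree_one {v : V} {f : MvPolynomial V R} (hf : f ∈ lowDegree R v 1) :
    f ∈ lowerPoly R v := by
  obtain ⟨a, ha, g, hg, rfl⟩ := exists_eq_of_mem_lowDegree_succ hf
  simpa [lowDegree_zero hg] using ha

theorem exists_mem_lowDegree_of_mem_supported {v : V} {f : MvPolynomial V R}
    (hf : f ∈ supported R (Set.Iic v)) : ∃ n, f ∈ lowDegree R v n := by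
  rw [supported] at hf
  refine Algebra.adjoin_induction ?_ ?_ ?_ ?_ hf
  · rintro _ ⟨w, hw, rfl⟩
    rcases eq_or_lt_of_le (Set.mem_Iic.1 hw) with rfl | h
    · exact ⟨2, by simpa using mul_X_pow_mem_lowDegree (one_mem (lowerPoly R w)) one_lt_two⟩
    · exact ⟨1, mem_lowDegree_of_mem_lowerPoly (Algebra.subset_adjoin ⟨w, h, rfl⟩) one_pos⟩
  · exact fun r => ⟨1, mem_lowDegree_of_mem_lowerPoly (Subalgebra.algebraMap_mem _ r) one_pos⟩
  · rintro f g _ _ ⟨m, hm⟩ ⟨n, hn⟩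
    exact ⟨max m n, add_mem (lowDegree_mono (le_max_left _ _) hm)
      (lowDegree_mono (le_max_right _ _) hn)⟩
  · rintro f g _ _ ⟨m, hm⟩ ⟨n, hn⟩
    refine ⟨m + n, ?_⟩
    refine lowDegree_induction (p := fun f => f * g ∈ lowDegree R v (m + n)) ?_ ?_ ?_ hm
    · intro a ha i hi
      exact lowDegree_mono (by omega) (mul_X_pow_mul_mem_lowDegree ha hn)
    · simp
    · intro f f' hf hf'
      rw [add_mul]
      exact add_mem hf hf'

/-- The indeterminate `v` is the leader of `f`. That it occurs in `f` makes it smaller than any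
strict bound on the indeterminates of `f`, as the induction on leaders requires. -/
theorem exists_C_or_exists_mem_lowDegree (f : MvPolynomial V R) :
    (∃ r, f = C r) ∨ ∃ v ∈ f.vars, ∃ n, f ∈ lowDegree R v n := by
  classical
  rcases f.vars.eq_empty_or_nonempty with h | h
  · exact Or.inl ⟨_, vars_eq_empty_iff_eq_C.1 h⟩
  · refine Or.inr ⟨f.vars.max' h, Finset.max'_mem _ _, exists_mem_lowDegree_of_mem_supported ?_⟩
    rw [mem_supported]
    exact fun w hw => Finset.le_max' _ _ hw

theorem pderiv_eq_zero_of_mem_lowerPoly {v : V} {a : MvPolynomial V R} (ha : a ∈ lowerPoly R v) :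
    pderiv v a = 0 :=
  pderiv_eq_zero_of_notMem_vars fun h => lt_irrefl v (mem_supported.1 ha h)

theorem pderiv_mul_X_pow {v : V} {a : MvPolynomial V R} (ha : a ∈ lowerPoly R v) (i : ℕ) :
    pderiv v (a * X v ^ i) = (i : MvPolynomial V R) * a * X v ^ (i - 1) := by
  rw [pderiv_mul, pderiv_eq_zero_of_mem_lowerPoly ha, pderiv_pow, pderiv_X_self]
  ring

theorem pderiv_mem_lowDegree {v : V} {n : ℕ} {f : MvPolynomial V R}
    (hf : f ∈ lowDegree R v (n + 1)) : pderiv v f ∈ lowDegree R v n := by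
  refine lowDegree_induction (p := fun f => pderiv v f ∈ lowDegree R v n) ?_ ?_ ?_ hf
  · intro a ha i hi
    rw [pderiv_mul_X_pow ha]
    rcases i with _ | i
    · simp
    · exact mul_X_pow_mem_lowDegree (mul_mem (natCast_mem _ _) ha) (by simpa using hi)
  · simp
  · intro f g hf hg
    rw [map_add]
    exact add_mem hf hg

theorem X_mul_pderiv_mem_lowDegree {v : V} {n : ℕ} {f : MvPolynomial V R}
    (hf : f ∈ lowDegree R v n) : X v * pderiv v f ∈ lowDegree R v n := by
  rcases n with _ | n
  · simp [lowDegree_zero hf]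
  · have := mul_X_pow_mul_mem_lowDegree (j := 1) (one_mem _) (pderiv_mem_lowDegree hf)
    rwa [one_mul, pow_one, add_comm] at this

/-- Euler's identity cancels the leading term. In characteristic zero this recovers `f` from its
separant and a polynomial of lower degree. -/
theorem natCast_mul_sub_X_mul_pderiv {v : V} {n : ℕ} {a g : MvPolynomial V R}
    (ha : a ∈ lowerPoly R v) (hg : g ∈ lowDegree R v n) :
    (n : MvPolynomial V R) * (a * X v ^ n + g) - X v * pderiv v (a * X v ^ n + g) ∈
      lowDegree R v n := by
  have h : X v * pderiv v (a * X v ^ n) = (n : MvPolynomial V R) * (a * X v ^ n) := by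
    rw [pderiv_mul_X_pow ha]
    rcases n with _ | n
    · simp
    · simp only [Nat.add_sub_cancel, pow_succ]
      ring
  rw [map_add, mul_add, mul_add, h, add_sub_add_left_eq_sub]
  exact sub_mem (mul_mem_lowDegree (natCast_mem _ _) hg) (X_mul_pderiv_mem_lowDegree hg)

theorem pseudo_remainder_mem_lowDegree {v : V} {m n : ℕ} (h : m ≤ n) {a b f g : MvPolynomial V R}
    (ha : a ∈ lowerPoly R v) (hb : b ∈ lowerPoly R v) (hf : f ∈ lowDegree R v n)
    (hg : g ∈ lowDegree R v m) :
    b * (a * X v ^ n + f) - a * X v ^ (n - m) * (b * X v ^ m + g) ∈ lowDegree R v n := by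
  have : b * (a * X v ^ n + f) - a * X v ^ (n - m) * (b * X v ^ m + g) =
      b * f - a * X v ^ (n - m) * g := by
    obtain ⟨k, rfl⟩ := Nat.exists_eq_add_of_le h
    rw [Nat.add_sub_cancel_left, pow_add]
    ring
  rw [this]
  refine sub_mem (mul_mem_lowDegree hb hf) ?_
  have := mul_X_pow_mul_mem_lowDegree (j := n - m) ha hg
  rwa [Nat.sub_add_cancel h] at this

/-- `f` is a polynomial in the indeterminates up to `v`, of the form `a * X v ^ n + g` with `a`
free of `v` and `g` of degree less than `n` in `v`. -/
structure HasLeadingTerm (f : MvPolynomial V R) (v : V) (n : ℕ) (a : MvPolynomial V R) : Prop where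
  coeff_mem : a ∈ lowerPoly R v
  sub_mem : f - a * X v ^ n ∈ lowDegree R v n

theorem HasLeadingTerm.mem_lowDegree {f a : MvPolynomial V R} {v : V} {n : ℕ}
    (h : HasLeadingTerm f v n a) : f ∈ lowDegree R v (n + 1) := by
  have := add_mem (mul_X_pow_mem_lowDegree h.1 n.lt_succ_self) (lowDegree_mono n.le_succ h.2)
  rwa [add_sub_cancel] at this

theorem exists_hasLeadingTerm {f : MvPolynomial V R} {v : V} {n : ℕ}
    (hf : f ∈ lowDegree R v (n + 1)) : ∃ a, HasLeadingTerm f v n a := by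
  obtain ⟨a, ha, g, hg, rfl⟩ := exists_eq_of_mem_lowDegree_succ hf
  exact ⟨a, ha, by simpa using hg⟩

end Leaders

/-! ### Extension of the operators to polynomial rings. -/

section Operators

open MvPolynomial

variable {K : Type*} [Field K] {R : Type*} [CommRing R] [Algebra K R] {T : Type*}

/-- The endomorphism of a polynomial ring over `R` that extends `s` and maps the indeterminates
to each other according to `S`. -/
def extendEndo (s : R →ₐ[K] R) (S : T → T) : MvPolynomial T R →ₐ[K] MvPolynomial T R :=
  MvPolynomial.aevalTower ((IsScalarTower.toAlgHom K R (MvPolynomial T R)).comp s)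
    (fun v => MvPolynomial.X (S v))

@[simp]
theorem extendEndo_C (s : R →ₐ[K] R) (S : T → T) (r : R) :
    extendEndo s S (C r) = C (s r) := by
  simp [extendEndo, algebraMap_eq]

@[simp]
theorem extendEndo_X (s : R →ₐ[K] R) (S : T → T) (v : T) :
    extendEndo s S (X v) = X (S v) := by
  simp [extendEndo]

@[simp]
theorem extendDerivation_C (d : Derivation K R R) (v : T → MvPolynomial T R) (r : R) :
    extendDerivation d v (C r) = C (d r) := by
  classical
  have h : mapCoeffs d (C r : MvPolynomial T R) = C (d r) := by
    ext t
    rw [coeff_mapCoeffs, coeff_C, coeff_C]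
    split_ifs <;> simp
  have h' : coeffDerivation T d (C r : MvPolynomial T R) = C (d r) := h
  simp [extendDerivation, h']

@[simp]
theorem extendDerivation_X (d : Derivation K R R) (v : T → MvPolynomial T R) (t : T) :
    extendDerivation d v (X t) = v t := by
  classical
  have h : mapCoeffs d (X t : MvPolynomial T R) = 0 := by
    ext t
    rw [coeff_mapCoeffs, coeff_X]
    split_ifs <;> simp
  have h' : coeffDerivation T d (X t : MvPolynomial T R) = 0 := h
  simp [extendDerivation, h']

end Operators

/-! ### Reduction and the general basis theorem. -/

section Leaders

open MvPolynomial

variable {K : Type*} [Field K] {V : Type*} [LinearOrder V] {R : Type*} [CommRing R] [Algebra K R]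
variable {d : Derivation K R R} {s : R →ₐ[K] R} {D S : V → V}

theorem lowerPoly_mono {v w : V} (h : v ≤ w) : lowerPoly R v ≤ lowerPoly R w :=
  supported_mono (Set.Iio_subset_Iio h)

theorem X_mem_lowerPoly {v w : V} (h : v < w) : (X v : MvPolynomial V R) ∈ lowerPoly R w :=
  Algebra.subset_adjoin ⟨v, h, rfl⟩

theorem mem_lowerPoly_of_mem_lowDegree {v w : V} (h : v < w) {n : ℕ} {f : MvPolynomial V R}
    (hf : f ∈ lowDegree R v n) : f ∈ lowerPoly R w := by
  refine lowDegree_induction (p := fun f => f ∈ lowerPoly R w) ?_ (zero_mem _)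
    (fun _ _ => add_mem) hf
  exact fun a ha i _ => mul_mem (lowerPoly_mono h.le ha) (pow_mem (X_mem_lowerPoly h) i)

theorem extendEndo_mem_lowerPoly (hS : StrictMono S) {v : V} {a : MvPolynomial V R}
    (ha : a ∈ lowerPoly R v) : extendEndo s S a ∈ lowerPoly R (S v) := by
  refine Algebra.adjoin_induction (p := fun a _ => extendEndo s S a ∈ lowerPoly R (S v))
    ?_ ?_ ?_ ?_ ha
  · rintro _ ⟨w, hw, rfl⟩
    rw [extendEndo_X]
    exact X_mem_lowerPoly (hS hw)
  · intro r
    rw [algebraMap_eq, extendEndo_C]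
    exact Subalgebra.algebraMap_mem _ _
  · intro f g _ _ hf hg
    rw [map_add]
    exact add_mem hf hg
  · intro f g _ _ hf hg
    rw [map_mul]
    exact mul_mem hf hg

theorem extendEndo_mem_lowDegree (hS : StrictMono S) {v : V} {n : ℕ} {f : MvPolynomial V R}
    (hf : f ∈ lowDegree R v n) : extendEndo s S f ∈ lowDegree R (S v) n := by
  refine lowDegree_induction (p := fun f => extendEndo s S f ∈ lowDegree R (S v) n) ?_ ?_ ?_ hf
  · intro a ha i hi
    rw [map_mul, map_pow, extendEndo_X]
    exact mul_X_pow_mem_lowDegree (extendEndo_mem_lowerPoly hS ha) hi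
  · simp
  · intro f g hf hg
    rw [map_add]
    exact add_mem hf hg

theorem HasLeadingTerm.extendEndo_iterate (s : R →ₐ[K] R) (hS : StrictMono S)
    {f a : MvPolynomial V R} {v : V} {n : ℕ} (h : HasLeadingTerm f v n a) (l : ℕ) :
    HasLeadingTerm ((extendEndo s S)^[l] f) (S^[l] v) n ((extendEndo s S)^[l] a) := by
  induction l with
  | zero => exact h
  | succ l ih =>
    simp only [Function.iterate_succ_apply']
    refine ⟨extendEndo_mem_lowerPoly hS ih.1, ?_⟩
    have := extendEndo_mem_lowDegree (s := s) hS ih.2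
    rwa [map_sub, map_mul, map_pow, extendEndo_X] at this

theorem extendDerivation_mem_lowerPoly (hD : StrictMono D) (hD' : ∀ v, v < D v) {v : V}
    {a : MvPolynomial V R} (ha : a ∈ lowerPoly R v) :
    extendDerivation d (fun v => X (D v)) a ∈ lowerPoly R (D v) := by
  refine Algebra.adjoin_induction
    (p := fun a _ => extendDerivation d (fun v => X (D v)) a ∈ lowerPoly R (D v)) ?_ ?_ ?_ ?_ ha
  · rintro _ ⟨w, hw, rfl⟩
    rw [extendDerivation_X]
    exact X_mem_lowerPoly (hD hw)
  · intro r
    rw [algebraMap_eq, extendDerivation_C]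
    exact Subalgebra.algebraMap_mem _ _
  · intro f g _ _ hf hg
    rw [map_add]
    exact add_mem hf hg
  · intro f g hf' hg' hf hg
    rw [Derivation.leibniz, smul_eq_mul, smul_eq_mul]
    exact add_mem (mul_mem (lowerPoly_mono (hD' v).le hf') hg)
      (mul_mem (lowerPoly_mono (hD' v).le hg') hf)

/-- By the product rule `X (D v)` arises only from differentiating powers of `X v`; strict
monotonicity of `D` keeps the derivatives of the coefficients below `D v`. -/
theorem extendDerivation_sub_mem_lowerPoly (hD : StrictMono D) (hD' : ∀ v, v < D v) {v : V} {n : ℕ}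
    {f : MvPolynomial V R} (hf : f ∈ lowDegree R v n) :
    extendDerivation d (fun v => X (D v)) f - pderiv v f * X (D v) ∈ lowerPoly R (D v) := by
  refine lowDegree_induction (p := fun f =>
    extendDerivation d (fun v => X (D v)) f - pderiv v f * X (D v) ∈ lowerPoly R (D v)) ?_ ?_ ?_ hf
  · intro a ha i hi
    have : extendDerivation d (fun v => X (D v)) (a * X v ^ i) -
        pderiv v (a * X v ^ i) * X (D v) = X v ^ i * extendDerivation d (fun v => X (D v)) a := by
      rw [pderiv_mul_X_pow ha, Derivation.leibniz, Derivation.leibniz_pow, extendDerivation_X]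
      simp only [smul_eq_mul, nsmul_eq_mul]
      ring
    rw [this]
    exact mul_mem (pow_mem (X_mem_lowerPoly (hD' v)) i) (extendDerivation_mem_lowerPoly hD hD' ha)
  · simp
  · intro f g hf hg
    have := add_mem hf hg
    simp only [map_add, add_mul]
    convert this using 1
    ring

/-- Every proper derivative is linear in its leader, with the separant of `f` as initial. The shift
`k + 1` excludes `f` itself, whose initial is `a`. -/
theorem HasLeadingTerm.extendDerivation_iterate (d : Derivation K R R) (hD : StrictMono D)
    (hD' : ∀ v, v < D v) {f a : MvPolynomial V R} {v : V} {n : ℕ} (h : HasLeadingTerm f v n a)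
    (k : ℕ) :
    HasLeadingTerm ((extendDerivation d (fun v => X (D v)))^[k + 1] f) (D^[k + 1] v) 1
      (pderiv v f) := by
  induction k with
  | zero =>
    rw [zero_add, Function.iterate_one, Function.iterate_one]
    refine ⟨mem_lowerPoly_of_mem_lowDegree (hD' v) (pderiv_mem_lowDegree h.mem_lowDegree), ?_⟩
    rw [pow_one]
    exact mem_lowDegree_of_mem_lowerPoly
      (extendDerivation_sub_mem_lowerPoly hD hD' h.mem_lowDegree) one_pos
  | succ k ih =>
    rw [Function.iterate_succ_apply', Function.iterate_succ_apply' D]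
    refine ⟨lowerPoly_mono (hD' _).le ih.1, mem_lowDegree_of_mem_lowerPoly ?_ one_pos⟩
    have h1 := extendDerivation_sub_mem_lowerPoly (d := d) hD hD' ih.mem_lowDegree
    have h2 : pderiv (D^[k + 1] v) ((extendDerivation d (fun v => X (D v)))^[k + 1] f) =
        pderiv v f := by
      have h3 := pderiv_eq_zero_of_mem_lowerPoly (mem_lowDegree_one ih.2)
      have h4 := pderiv_mul_X_pow ih.1 1
      rw [map_sub, sub_eq_zero] at h3
      rw [h3, h4]
      simp
    rwa [h2, ← pow_one (X (D (D^[k + 1] v)))] at h1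

/-- A prime ideal `P` is contained in a reflexive ideal `J` if `J` contains the constants of `P`
and every element of `P` whose initial and separant are not in `P` can be reduced by an element
of `J` with respect to which `J` is saturated. -/
theorem le_of_exists_reduction [CharZero K] [WellFoundedLT V] (hD : StrictMono D)
    (hD' : ∀ v, v < D v) (hS : StrictMono S) {P J : Ideal (MvPolynomial V R)}
    (hJP : J ≤ P)
    (hJ : IsReflexive (extendDerivation d fun v => X (D v)) (extendEndo s S) J)
    (hC : ∀ r, C r ∈ P → C r ∈ J)
    (hred : ∀ (f : MvPolynomial V R) (v : V) (n : ℕ) (a : MvPolynomial V R), f ∈ P →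
      HasLeadingTerm f v n a → 0 < n → a ∉ P → pderiv v f ∉ P →
      ∃ (g : MvPolynomial V R) (u : V) (m : ℕ) (b : MvPolynomial V R), g ∈ J ∧
        HasLeadingTerm g u m b ∧ m ≤ n ∧ (∃ k l, S^[l] (D^[k] u) = v) ∧
        (∀ l q, (extendEndo s S)^[l] b * q ∈ J → q ∈ J) ∧
        ∀ l q, (extendEndo s S)^[l] (pderiv u g) * q ∈ J → q ∈ J) :
    P ≤ J := by
  have hendo : ∀ l f, f ∈ J → (extendEndo s S)^[l] f ∈ J := by
    intro l f hf
    induction l with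
    | zero => exact hf
    | succ l ih =>
      rw [Function.iterate_succ_apply']
      exact hJ.endo_mem _ ih
  have hder : ∀ k f, f ∈ J → (extendDerivation d fun v => X (D v))^[k] f ∈ J := by
    intro k f hf
    induction k with
    | zero => exact hf
    | succ k ih =>
      rw [Function.iterate_succ_apply']
      exact hJ.deriv_mem _ ih
  have hnat : ∀ (n : ℕ) f, 0 < n → (n : MvPolynomial V R) * f ∈ J → f ∈ J := by
    intro n f hn hf
    have h1 := J.mul_mem_left (algebraMap K _ (n : K)⁻¹) hf
    rwa [← mul_assoc, ← map_natCast (algebraMap K (MvPolynomial V R)), ← map_mul,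
      inv_mul_cancel₀ (Nat.cast_ne_zero.2 hn.ne'), map_one, one_mul] at h1
  have main : ∀ (v : V) (n : ℕ) (f : MvPolynomial V R), f ∈ P → f ∈ lowDegree R v n → f ∈ J := by
    intro v
    induction v using WellFoundedLT.induction with
    | ind v ihv =>
    have hlow : ∀ a ∈ P, a ∈ lowerPoly R v → a ∈ J := by
      intro a haP ha
      rcases exists_C_or_exists_mem_lowDegree a with ⟨r, rfl⟩ | ⟨w, hw, n, hn⟩
      · exact hC r haP
      · exact ihv w (mem_supported.1 ha hw) n a haP hn
    intro n
    induction n with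
    | zero =>
      intro f _ hf
      rw [lowDegree_zero hf]
      exact J.zero_mem
    | succ n ih =>
      intro f hfP hf
      rcases Nat.eq_zero_or_pos n with rfl | hn
      · exact hlow f hfP (mem_lowDegree_one hf)
      obtain ⟨a, ha⟩ := exists_hasLeadingTerm hf
      have hfeq : f = a * X v ^ n + (f - a * X v ^ n) := by ring
      -- If the initial is in `P`, both `a` and the tail are elements of `P` of lower rank.
      by_cases haP : a ∈ P
      · rw [hfeq]
        exact J.add_mem (J.mul_mem_right _ (hlow a haP ha.1))
          (ih _ (P.sub_mem hfP (P.mul_mem_right _ haP)) ha.2)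
      -- If the separant is in `P`, it and the Euler difference have lower degree in `v`, so `n * f
      -- ∈ J`.
      by_cases hpP : pderiv v f ∈ P
      · have h1 := natCast_mul_sub_X_mul_pderiv ha.1 ha.2
        rw [← hfeq] at h1
        have h2 := ih _ (P.sub_mem (P.mul_mem_left _ hfP) (P.mul_mem_left _ hpP)) h1
        have h3 := J.mul_mem_left (X v) (ih _ hpP (pderiv_mem_lowDegree hf))
        refine hnat n f hn ?_
        have := J.add_mem h2 h3
        rwa [sub_add_cancel] at this
      -- The pseudo-remainder of `f` by `g` lies in `P` because `J ≤ P`, and in `J` by induction;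
      -- hence `b * f ∈ J`, and saturation removes `b`.
      have reduce : ∀ (g b : MvPolynomial V R) (m : ℕ), g ∈ J → HasLeadingTerm g v m b → m ≤ n →
          (∀ q, b * q ∈ J → q ∈ J) → f ∈ J := by
        intro g b m hgJ hg hm hb
        have h1 := pseudo_remainder_mem_lowDegree hm ha.1 hg.1 ha.2 hg.2
        rw [add_sub_cancel, add_sub_cancel] at h1
        have h2 := J.mul_mem_left (a * X v ^ (n - m)) hgJ
        have h3 := J.add_mem (ih _ (P.sub_mem (P.mul_mem_left b hfP) (hJP h2)) h1) h2
        rw [sub_add_cancel] at h3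
        exact hb f h3
      obtain ⟨g, u, m, b, hg, hgb, hmn, ⟨k, l, rfl⟩, hb, hb'⟩ := hred f v n a hfP ha hn haP hpP
      -- Without differentiation the reducing polynomial has degree `m ≤ n` and initial `σ^l(b)`.
      -- With it, the degree is `1 ≤ n` and the initial is `σ^l` of the separant.
      rcases k with _ | k
      · exact reduce _ _ m (hendo l g hg) (hgb.extendEndo_iterate s hS l) hmn (hb l)
      · exact reduce _ _ 1 (hendo l _ (hder (k + 1) g hg))
          ((hgb.extendDerivation_iterate d hD hD' k).extendEndo_iterate s hS l) hn (hb' l)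
  intro f hf
  rcases exists_C_or_exists_mem_lowDegree f with ⟨r, rfl⟩ | ⟨v, -, n, hn⟩
  · exact hC r hf
  · exact main v n f hf hn

theorem IsReflexive.comap_C {T : Type*} {v : T → MvPolynomial T R} {S : T → T}
    {P : Ideal (MvPolynomial T R)}
    (hP : IsReflexive (extendDerivation d v) (extendEndo s S) P) :
    IsReflexive d s (P.comap (C : R →+* MvPolynomial T R)) := by
  refine ⟨fun a ha => ?_, fun a ha => ?_, fun a ha => ?_, ?_⟩
  · simpa [Ideal.mem_comap] using hP.deriv_mem _ (Ideal.mem_comap.1 ha)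
  · simpa [Ideal.mem_comap] using hP.endo_mem _ (Ideal.mem_comap.1 ha)
  · refine Ideal.mem_comap.2 (hP.mem_of_mul_endo_mem _ ?_)
    simpa [Ideal.mem_comap] using ha
  · rintro a ⟨n, hn⟩
    refine Ideal.mem_comap.2 (hP.mem_of_pow_mem n ?_)
    simpa [Ideal.mem_comap] using hn

/-- Multiplying by `σ^l(q)` gives `σ^l(h * q) * (h * q) ∈ I`, to which the perfectness condition
applies. -/
theorem IsReflexive.mem_of_iterate_mul_mul_mem {I : Ideal R} (hI : IsReflexive d s I) {h q : R}
    (l : ℕ) (hq : s^[l] h * (h * q) ∈ I) : h * q ∈ I := by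
  refine (isPerfectDiffDiffIdeal_iff.2 hI).2.2 _ [(0, 1), (l, 1)] ?_
  have := I.mul_mem_left (s^[l] q) hq
  simp only [List.map_cons, List.map_nil, List.prod_cons, List.prod_nil, pow_one, mul_one,
    iterate_map_mul, Function.iterate_zero, id_eq]
  convert this using 1
  ring

/-- **Basis theorem** for a polynomial ring whose derivation and endomorphism act on the
indeterminates through monotone maps `D` and `S` that generate a well-quasi-ordering. -/
theorem hasACC_extend [CharZero K] [WellFoundedLT V] (hD : StrictMono D)
    (hD' : ∀ v, v < D v) (hS : StrictMono S)
    (hbasis : ∀ T : Set (V × ℕ), ∃ T₀ : Finset (V × ℕ), (T₀ : Set (V × ℕ)) ⊆ T ∧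
      ∀ t ∈ T, ∃ t₀ ∈ T₀, t₀.2 ≤ t.2 ∧ ∃ k l, S^[l] (D^[k] t₀.1) = t.1)
    (hR : HasACC (IsReflexive d s)) :
    HasACC (IsReflexive (extendDerivation d fun v => X (D v)) (extendEndo s S)) := by
  classical
  refine hasACC_of_isFinitelyClosed fun I hI => ?_
  by_contra hn
  obtain ⟨P, hP, hPn, hmax⟩ := exists_maximal_not_isFinitelyClosed hI hn
  have hprime := isPrime_of_maximal_not_isFinitelyClosed hP hPn hmax
  obtain ⟨F₀, hF₀⟩ := hR.isFinitelyClosed hP.comap_C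
  -- The `f t` chosen below may be any elements of `P` with the prescribed leader and degree; they
  -- need not be reduced with respect to each other.
  obtain ⟨T₀, hT₀, hT⟩ := hbasis {t | 0 < t.2 ∧ ∃ f a : MvPolynomial V R, f ∈ P ∧
    HasLeadingTerm f t.1 t.2 a ∧ a ∉ P ∧ pderiv t.1 f ∉ P}
  have hT₀' : ∀ t ∈ T₀, ∃ f a : MvPolynomial V R, f ∈ P ∧
    HasLeadingTerm f t.1 t.2 a ∧ a ∉ P ∧ pderiv t.1 f ∉ P := fun t ht => (hT₀ ht).2
  choose! f a hfP hfa haP hpP using hT₀'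
  let F : Finset (MvPolynomial V R) := F₀.image C ∪ T₀.image f
  let H : MvPolynomial V R := ∏ t ∈ T₀, a t * pderiv t.1 (f t)
  have hF : (F : Set (MvPolynomial V R)) ⊆ P := by
    intro x hx
    rcases Finset.mem_union.1 (Finset.mem_coe.1 hx) with hx | hx
    · obtain ⟨r, hr, rfl⟩ := Finset.mem_image.1 hx
      have : r ∈ P.comap (C : R →+* MvPolynomial V R) := by
        rw [hF₀]
        exact subset_reflClosure _ hr
      exact this
    · obtain ⟨t, ht, rfl⟩ := Finset.mem_image.1 hx
      exact hfP t ht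
  have hH : H ∉ P := by
    intro h
    obtain ⟨t, ht, h⟩ := hprime.prod_mem_iff.1 h
    exact (hprime.mem_or_mem h).elim (haP t ht) (hpP t ht)
  refine hPn (isFinitelyClosed_of_mul_mem hP hmax hH hF ?_)
  have hQ := isReflexive_reflClosure (d := extendDerivation d fun v => X (D v))
    (s := extendEndo s S) (F : Set (MvPolynomial V R))
  have hQP := reflClosure_le hP hF
  have hsub := subset_reflClosure (d := extendDerivation d fun v => X (D v))
    (s := extendEndo s S) (F : Set (MvPolynomial V R))
  generalize reflClosure (extendDerivation d fun v => X (D v)) (extendEndo s S)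
    (F : Set (MvPolynomial V R)) = Q at hQ hQP hsub
  have hle : Q ≤ setColon Q {H} := fun q hq t _ => Q.mul_mem_left t hq
  -- Multiplying by `σ^l` of the cofactor of `b` in `H` gives `σ^l(H) * (H * q) ∈ Q`, and
  -- reflexivity of `Q` drops `σ^l(H)`.
  have hsat : ∀ (b : MvPolynomial V R), b ∣ H → ∀ l q,
      (extendEndo s S)^[l] b * q ∈ setColon Q {H} → q ∈ setColon Q {H} := by
    rintro b ⟨c, hc⟩ l q hq t rfl
    have h1 := Q.mul_mem_left ((extendEndo s S)^[l] c) (hq H rfl)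
    refine hQ.mem_of_iterate_mul_mul_mem l ?_
    have h2 : (extendEndo s S)^[l] H = (extendEndo s S)^[l] b * (extendEndo s S)^[l] c := by
      rw [hc, iterate_map_mul]
    rw [h2]
    convert h1 using 1
    ring
  have hPJ : P ≤ setColon Q {H} := by
    refine le_of_exists_reduction hD hD' hS ?_ (hQ.setColon _) ?_ ?_
    · exact fun q hq => (hprime.mem_or_mem (hQP (hq H rfl))).resolve_left hH
    · intro r hr
      -- The contraction of `Q` to `R` is reflexive and contains `F₀`, hence contains all constants
      -- of `P`.
      have h1 : r ∈ reflClosure d s (F₀ : Set R) := hF₀ ▸ hr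
      refine hle (reflClosure_le hQ.comap_C (fun x hx => hsub ?_) h1)
      exact Finset.mem_union_left _ (Finset.mem_image_of_mem _ hx)
    · intro g v n b hg hgb hn hb hgp
      obtain ⟨t, ht, htn, hkl⟩ := hT (v, n) ⟨hn, g, b, hg, hgb, hb, hgp⟩
      have hdvd := Finset.dvd_prod_of_mem (fun t => a t * pderiv t.1 (f t)) ht
      refine ⟨f t, t.1, t.2, a t, hle (hsub ?_), hfa t ht, htn, hkl, ?_, ?_⟩
      · exact Finset.mem_union_right _ (Finset.mem_image_of_mem _ ht)
      · exact hsat _ ((dvd_mul_right _ _).trans hdvd)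
      · exact hsat _ ((dvd_mul_left _ _).trans hdvd)
  exact fun q hq => hPJ hq H rfl

end Leaders

/-! ### Coordinates on `R ⊗ D` and the `D`-ring axioms. -/

section Structures

universe uK uD uR

variable {K : Type uK} [Field K] {D : Type uD} [CommRing D] [Algebra K D]
variable {R : Type uR} [CommRing R] [Algebra K R]

/-- The coordinate of `R ⊗ D` attached to a linear form on `D`. -/
def tensorCoord (R : Type uR) [CommRing R] [Algebra K R] (f : D →ₗ[K] K) : R ⊗[K] D →ₗ[K] R :=
  (TensorProduct.rid K R).toLinearMap ∘ₗ LinearMap.lTensor R f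

@[simp]
theorem tensorCoord_tmul (f : D →ₗ[K] K) (r : R) (x : D) :
    tensorCoord R f (r ⊗ₜ x) = f x • r := by
  simp [tensorCoord]

theorem coord_apply {m : ℕ} (b : Module.Basis (Fin m) K D) (e : R →ₐ[K] R ⊗[K] D) (i : Fin m)
    (r : R) : coord b e i r = tensorCoord R (b.coord i) (e r) :=
  rfl

theorem eq_sum_tensorCoord {m : ℕ} (b : Module.Basis (Fin m) K D) (x : R ⊗[K] D) :
    x = ∑ i, tensorCoord R (b.coord i) x ⊗ₜ[K] b i := by
  induction x using TensorProduct.induction_on with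
  | zero => simp
  | tmul r x =>
    simp only [tensorCoord_tmul, TensorProduct.smul_tmul, ← TensorProduct.tmul_sum]
    simp [b.sum_repr]
  | add x y hx hy =>
    simp only [map_add, TensorProduct.add_tmul, Finset.sum_add_distrib, ← hx, ← hy]

theorem tensorCoord_mem {I : Ideal R} (f : D →ₗ[K] K) {x : R ⊗[K] D}
    (hx : x ∈ I.map (Algebra.TensorProduct.includeLeft : R →ₐ[K] R ⊗[K] D)) :
    tensorCoord R f x ∈ I := by
  -- The claim is strengthened to all multiples `y * x`, which makes the scalar case immediate; `y =
  -- 1` recovers it.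
  refine Submodule.span_induction ?_ ?_ ?_ ?_ hx (p := fun x _ => ∀ y, tensorCoord R f (y * x) ∈ I)
    1 |> fun h => by simpa using h
  · rintro _ ⟨a, ha, rfl⟩ y
    induction y using TensorProduct.induction_on with
    | zero => simp
    | tmul r y =>
      simp only [Algebra.TensorProduct.includeLeft_apply,
        Algebra.TensorProduct.tmul_mul_tmul, tensorCoord_tmul, Algebra.smul_def]
      exact I.mul_mem_left _ (I.mul_mem_left _ ha)
    | add y z hy hz =>
      rw [add_mul, map_add]
      exact I.add_mem hy hz
  · simp
  · intro x y _ _ hx hy z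
    rw [mul_add, map_add]
    exact I.add_mem (hx z) (hy z)
  · intro c x _ hx y
    rw [smul_eq_mul, ← mul_assoc]
    exact hx _

theorem tmul_mem_map {I : Ideal R} {a : R} (ha : a ∈ I) (x : D) :
    a ⊗ₜ[K] x ∈ I.map (Algebra.TensorProduct.includeLeft : R →ₐ[K] R ⊗[K] D) := by
  have := Ideal.mul_mem_left
    (I.map (Algebra.TensorProduct.includeLeft : R →ₐ[K] R ⊗[K] D)) (1 ⊗ₜ[K] x)
    (Ideal.mem_map_of_mem _ ha)
  simpa using this

/-- The operators attached to two linear forms on `D` commute in a `D*`-ring. -/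
theorem IsDStarRing.tensorCoord_comm {e : R →ₐ[K] R ⊗[K] D} (he : IsDStarRing e)
    (f g : D →ₗ[K] K) (r : R) :
    tensorCoord R f (e (tensorCoord R g (e r))) = tensorCoord R g (e (tensorCoord R f (e r))) := by
  have h1 : ∀ (f g : D →ₗ[K] K) (x : R ⊗[K] D), tensorCoord R f (tensorCoord (R ⊗[K] D) g
      (mapD D e x)) = tensorCoord R f (e (tensorCoord R g x)) := by
    intro f g x
    induction x using TensorProduct.induction_on with
    | zero => simp
    | tmul r x => simp [mapD]
    | add x y hx hy => simp only [map_add, hx, hy]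
  have h2 : ∀ x : (R ⊗[K] D) ⊗[K] D,
      tensorCoord R f (tensorCoord (R ⊗[K] D) g (TensorProduct.rightComm K R D D x)) =
        tensorCoord R g (tensorCoord (R ⊗[K] D) f x) := by
    intro x
    induction x using TensorProduct.induction_on with
    | zero => simp
    | tmul x y =>
      induction x using TensorProduct.induction_on with
      | zero => simp
      | tmul r x => simp [smul_smul, mul_comm]
      | add x y hx hy => simp only [TensorProduct.add_tmul, map_add, hx, hy]
    | add x y hx hy => simp only [map_add, hx, hy]
  rw [← h1, ← h1, ← h2, he r]

theorem assocEndo_apply (e : R →ₐ[K] R ⊗[K] D) (π : D →ₐ[K] K) (r : R) :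
    assocEndo e π r = tensorCoord R π.toLinearMap (e r) := by
  have h : ∀ x : R ⊗[K] D, Algebra.TensorProduct.rid K K R
      (Algebra.TensorProduct.map (AlgHom.id K R) π x) = tensorCoord R π.toLinearMap x := by
    intro x
    induction x using TensorProduct.induction_on with
    | zero => simp
    | tmul r x => simp
    | add x y hx hy => simp only [map_add, hx, hy]
  exact h _

theorem isDHom_of_polynomial {T : Type*} {S : Type*} [CommRing S] [Algebra K S]
    {e : MvPolynomial T R →ₐ[K] MvPolynomial T R ⊗[K] D} {f : S →ₐ[K] S ⊗[K] D}
    {φ : MvPolynomial T R →ₐ[K] S}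
    (hC : ∀ r, mapD D φ (e (MvPolynomial.C r)) = f (φ (MvPolynomial.C r)))
    (hX : ∀ t, mapD D φ (e (MvPolynomial.X t)) = f (φ (MvPolynomial.X t))) : IsDHom e f φ := by
  intro p
  induction p using MvPolynomial.induction_on with
  | C r => exact hC r
  | add p q hp hq => rw [map_add, map_add, map_add, map_add, hp, hq]
  | mul_X p t hp => rw [map_mul, map_mul, map_mul, map_mul, hp, hX]

end Structures

/-! ### Dual numbers and differential rings. -/

section Differential

universe uK uR

variable {K : Type uK} [Field K] {R : Type uR} [CommRing R] [Algebra K R]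

theorem diffStructure_apply (d : Derivation K R R) (r : R) :
    diffStructure d r = r ⊗ₜ[K] (1 : K[ε]) + d r ⊗ₜ[K] (ε : K[ε]) :=
  rfl

theorem basisEps_zero : basisEps K 0 = 1 := by
  simp [basisEps]

theorem basisEps_one : basisEps K 1 = ε := by
  simp [basisEps]

theorem basisEps_repr_zero (x : K[ε]) : (basisEps K).repr x 0 = x.fst :=
  rfl

theorem basisEps_repr_one (x : K[ε]) : (basisEps K).repr x 1 = x.snd :=
  rfl

theorem isDStarRing_diffStructure (d : Derivation K R R) : IsDStarRing (diffStructure d) := by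
  intro r
  simp only [diffStructure_apply, mapD, map_add, Algebra.TensorProduct.map_tmul, AlgHom.coe_id,
    id_eq, TensorProduct.add_tmul, TensorProduct.rightComm_tmul]
  abel

/-- The nilpotent `ε` must map to zero in the field `K`, so the residue map is the only
homomorphism. -/
theorem algHom_dualNumber_apply (π : K[ε] →ₐ[K] K) (x : K[ε]) : π x = x.fst := by
  have h : π ε = 0 := by
    have : π ε * π ε = 0 := by rw [← map_mul, DualNumber.eps_mul_eps, map_zero]
    simpa using this
  have hx : x = x.fst • (1 : K[ε]) + x.snd • ε := by
    ext <;> simp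
  conv_lhs => rw [hx]
  rw [map_add, map_smul, map_smul, h, smul_zero, add_zero, map_one, smul_eq_mul, mul_one]

theorem assocEndo_diffStructure (d : Derivation K R R) (π : K[ε] →ₐ[K] K) (r : R) :
    assocEndo (diffStructure d) π r = r := by
  simp [assocEndo_apply, diffStructure_apply, algHom_dualNumber_apply]

theorem assocEndosInjective_diffStructure (d : Derivation K R R) :
    AssocEndosInjective (diffStructure d) := by
  intro π x y h
  rwa [assocEndo_diffStructure, assocEndo_diffStructure] at h

theorem isPerfectDIdeal_diffStructure_iff (d : Derivation K R R) (I : Ideal R) :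
    IsPerfectDIdeal (diffStructure d) I ↔ IsRadicalDiffIdeal d I := by
  constructor
  · rintro ⟨h1, -, h3⟩
    refine ⟨fun a ha => ?_, h3⟩
    have := tensorCoord_mem ((basisEps K).coord 1) (h1 a ha)
    simpa [diffStructure_apply, basisEps_repr_one] using this
  · rintro ⟨h1, h2⟩
    refine ⟨fun a ha => ?_, fun π a ha => ?_, h2⟩
    · rw [diffStructure_apply]
      exact Ideal.add_mem _ (tmul_mem_map ha _) (tmul_mem_map (h1 a ha) _)
    · rw [assocEndo_diffStructure] at ha
      exact h2 ⟨2, by rwa [pow_two]⟩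

theorem exists_derivation_iff (e : R →ₐ[K] R ⊗[K] K[ε]) :
    (IsDStarRing e ∧ ∀ r, coord (basisEps K) e 0 r = r) ↔
      ∃ d : Derivation K R R, e = diffStructure d ∧ ∀ r, coord (basisEps K) e 1 r = d r := by
  constructor
  · rintro ⟨-, h0⟩
    have he : ∀ r, e r = r ⊗ₜ[K] (1 : K[ε]) + coord (basisEps K) e 1 r ⊗ₜ[K] (ε : K[ε]) := by
      intro r
      conv_lhs => rw [eq_sum_tensorCoord (basisEps K) (e r)]
      rw [Fin.sum_univ_two, ← coord_apply, ← coord_apply, h0, basisEps_zero, basisEps_one]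
    let d : Derivation K R R := Derivation.mk' (coord (basisEps K) e 1) (by
      intro x y
      rw [coord_apply, map_mul, he x, he y]
      simp [add_mul, mul_add, basisEps_repr_one]
      ring)
    exact ⟨d, AlgHom.ext he, fun _ => rfl⟩
  · rintro ⟨d, rfl, -⟩
    refine ⟨isDStarRing_diffStructure d, fun r => ?_⟩
    simp [coord_apply, diffStructure_apply, basisEps_repr_zero]

theorem isDHom_diffPoly (ι : Type*) (d : Derivation K R R) :
    IsDHom (diffStructure d) (diffStructure (diffPolyDeriv ι d))
      (IsScalarTower.toAlgHom K R (DiffPoly ι R)) := by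
  intro r
  simp [diffStructure_apply, mapD, diffPolyDeriv, MvPolynomial.algebraMap_eq]

theorem exists_surjective_diffPoly (ι : Type*) (d : Derivation K R R) :
    ∃ φ : DStarPoly 2 ι R →ₐ[R] DiffPoly ι R,
      IsDHom (polyStructure (basisEps K) ι (diffStructure d))
        (diffStructure (diffPolyDeriv ι d)) (φ.restrictScalars K) ∧
      Function.Surjective φ ∧
      ∀ (i : ι) (θ : Fin 2 → ℕ), φ (MvPolynomial.X (i, θ)) = MvPolynomial.X (i, θ 1) := by
  -- The exponent of `σ = id` is forgotten; any value of it gives a preimage.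
  refine ⟨MvPolynomial.rename fun v => (v.1, v.2 1), ?_,
    MvPolynomial.rename_surjective _ fun v => ⟨(v.1, fun _ => v.2), rfl⟩, by simp⟩
  refine isDHom_of_polynomial (fun r => ?_) fun t => ?_
  · simp [diffStructure_apply, mapD, diffPolyDeriv, polyStructure, MvPolynomial.algebraMap_eq]
  · simp [diffStructure_apply, mapD, diffPolyDeriv, polyStructure, basisEps_zero, basisEps_one]

end Differential

/-! ### The product with `K` and difference-differential rings. -/

section DifferenceDifferential

universe uK uR

variable {K : Type uK} [Field K] {R : Type uR} [CommRing R] [Algebra K R]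

theorem diffDiffStructure_apply (d : Derivation K R R) (s : R →ₐ[K] R) (r : R) :
    diffDiffStructure d s r = r ⊗ₜ[K] ((1, 0) : K[ε] × K) + d r ⊗ₜ[K] ((ε, 0) : K[ε] × K) +
      s r ⊗ₜ[K] ((0, 1) : K[ε] × K) :=
  rfl

theorem basisNu_zero : basisNu K 0 = (1, 0) := by
  simp [basisNu]

theorem basisNu_one : basisNu K 1 = (ε, 0) := by
  simp [basisNu]

theorem basisNu_two : basisNu K 2 = (0, 1) := by
  simp [basisNu]

theorem basisNu_repr_zero (x : K[ε] × K) : (basisNu K).repr x 0 = x.1.fst :=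
  rfl

theorem basisNu_repr_one (x : K[ε] × K) : (basisNu K).repr x 1 = x.1.snd :=
  rfl

theorem basisNu_repr_two (x : K[ε] × K) : (basisNu K).repr x 2 = x.2 :=
  rfl

theorem isDStarRing_diffDiffStructure {d : Derivation K R R} {s : R →ₐ[K] R}
    (h : ∀ r, d (s r) = s (d r)) : IsDStarRing (diffDiffStructure d s) := by
  intro r
  simp only [diffDiffStructure_apply, mapD, map_add, Algebra.TensorProduct.map_tmul, AlgHom.coe_id,
    id_eq, TensorProduct.add_tmul, TensorProduct.rightComm_tmul, h]
  abel

/-- The orthogonal idempotents `(1, 0)` and `(0, 1)` map to elements of `K` with product `0` and sum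
`1`, so exactly one factor survives. -/
theorem algHom_dualNumber_prod (π : K[ε] × K →ₐ[K] K) :
    (∀ x, π x = x.1.fst) ∨ ∀ x, π x = x.2 := by
  have h : π (ε, 0) = 0 := by
    have : π (ε, 0) * π (ε, 0) = 0 := by
      rw [← map_mul, Prod.mk_mul_mk, DualNumber.eps_mul_eps, mul_zero, Prod.mk_zero_zero, map_zero]
    simpa using this
  have h1 : π (1, 0) + π (0, 1) = 1 := by
    rw [← map_add, Prod.mk_add_mk, add_zero, zero_add, ← Prod.one_eq_mk, map_one]
  have h2 : π (1, 0) * π (0, 1) = 0 := by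
    rw [← map_mul, Prod.mk_mul_mk, one_mul, zero_mul, Prod.mk_zero_zero, map_zero]
  have hx : ∀ x, π x = x.1.fst * π (1, 0) + x.2 * π (0, 1) := by
    intro x
    have e : x = x.1.fst • ((1, 0) : K[ε] × K) + x.1.snd • ((ε, 0) : K[ε] × K) +
        x.2 • ((0, 1) : K[ε] × K) := by
      ext <;> simp
    conv_lhs => rw [e]
    simp only [map_add, map_smul, h, mul_zero, add_zero, smul_eq_mul]
  rcases mul_eq_zero.1 h2 with h3 | h3
  · rw [h3, zero_add] at h1
    exact Or.inr fun x => by rw [hx x, h3, h1, mul_zero, zero_add, mul_one]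
  · rw [h3, add_zero] at h1
    exact Or.inl fun x => by rw [hx x, h3, h1, mul_zero, add_zero, mul_one]

theorem assocEndo_diffDiffStructure (d : Derivation K R R) (s : R →ₐ[K] R)
    (π : K[ε] × K →ₐ[K] K) :
    (∀ r, assocEndo (diffDiffStructure d s) π r = r) ∨
      ∀ r, assocEndo (diffDiffStructure d s) π r = s r := by
  rcases algHom_dualNumber_prod π with h | h
  · exact Or.inl fun r => by simp [assocEndo_apply, diffDiffStructure_apply, h]
  · exact Or.inr fun r => by simp [assocEndo_apply, diffDiffStructure_apply, h]

theorem assocEndo_diffDiffStructure_snd (d : Derivation K R R) (s : R →ₐ[K] R) (r : R) :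
    assocEndo (diffDiffStructure d s) (AlgHom.snd K K[ε] K) r = s r := by
  simp [assocEndo_apply, diffDiffStructure_apply]

theorem assocEndosInjective_diffDiffStructure_iff {d : Derivation K R R} {s : R →ₐ[K] R} :
    AssocEndosInjective (diffDiffStructure d s) ↔ Function.Injective s := by
  constructor
  · intro h x y hxy
    refine h (AlgHom.snd K K[ε] K) ?_
    rwa [assocEndo_diffDiffStructure_snd, assocEndo_diffDiffStructure_snd]
  · intro hs π x y hxy
    rcases assocEndo_diffDiffStructure d s π with h | h
    · rwa [h, h] at hxy
    · rw [h, h] at hxy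
      exact hs hxy

theorem isPerfectDIdeal_diffDiffStructure_iff (d : Derivation K R R) (s : R →ₐ[K] R)
    (I : Ideal R) :
    IsPerfectDIdeal (diffDiffStructure d s) I ↔ IsPerfectDiffDiffIdeal d s I := by
  rw [isPerfectDiffDiffIdeal_iff]
  constructor
  · rintro ⟨h1, h2, h3⟩
    refine ⟨fun a ha => ?_, fun a ha => ?_, fun a ha => ?_, h3⟩
    · have := tensorCoord_mem ((basisNu K).coord 1) (h1 a ha)
      simpa [diffDiffStructure_apply, basisNu_repr_one] using this
    · have := tensorCoord_mem ((basisNu K).coord 2) (h1 a ha)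
      simpa [diffDiffStructure_apply, basisNu_repr_two] using this
    · refine h2 (AlgHom.snd K K[ε] K) a ?_
      rwa [assocEndo_diffDiffStructure_snd]
  · rintro ⟨h1, h2, h3, h4⟩
    refine ⟨fun a ha => ?_, fun π a ha => ?_, h4⟩
    · rw [diffDiffStructure_apply]
      exact Ideal.add_mem _ (Ideal.add_mem _ (tmul_mem_map ha _) (tmul_mem_map (h1 a ha) _))
        (tmul_mem_map (h2 a ha) _)
    · rcases assocEndo_diffDiffStructure d s π with h | h
      · rw [h] at ha
        exact h4 ⟨2, by rwa [pow_two]⟩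
      · rw [h] at ha
        exact h3 a ha

theorem exists_derivation_endo_iff (e : R →ₐ[K] R ⊗[K] (K[ε] × K)) :
    (IsDStarRing e ∧ AssocEndosInjective e ∧ ∀ r, coord (basisNu K) e 0 r = r) ↔
      ∃ (d : Derivation K R R) (s : R →ₐ[K] R), e = diffDiffStructure d s ∧
        (∀ r, coord (basisNu K) e 1 r = d r) ∧ (∀ r, coord (basisNu K) e 2 r = s r) ∧
        Function.Injective s ∧ ∀ r, d (s r) = s (d r) := by
  constructor
  · rintro ⟨hstar, hinj, h0⟩
    have he : ∀ r, e r = r ⊗ₜ[K] ((1, 0) : K[ε] × K) +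
        coord (basisNu K) e 1 r ⊗ₜ[K] ((ε, 0) : K[ε] × K) +
        coord (basisNu K) e 2 r ⊗ₜ[K] ((0, 1) : K[ε] × K) := by
      intro r
      conv_lhs => rw [eq_sum_tensorCoord (basisNu K) (e r)]
      rw [Fin.sum_univ_three, ← coord_apply, ← coord_apply, ← coord_apply, h0, basisNu_zero,
        basisNu_one, basisNu_two]
    let d : Derivation K R R := Derivation.mk' (coord (basisNu K) e 1) (by
      intro x y
      rw [coord_apply, map_mul, he x, he y]
      simp [add_mul, mul_add, basisNu_repr_one]
      ring)
    let s : R →ₐ[K] R := AlgHom.ofLinearMap (coord (basisNu K) e 2)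
      (by simp [coord_apply, Algebra.TensorProduct.one_def, basisNu_repr_two])
      (by
        intro x y
        rw [coord_apply, map_mul, he x, he y]
        simp [add_mul, mul_add, basisNu_repr_two])
    have heq : e = diffDiffStructure d s := AlgHom.ext he
    refine ⟨d, s, heq, fun _ => rfl, fun _ => rfl, ?_, fun r => ?_⟩
    · rwa [heq, assocEndosInjective_diffDiffStructure_iff] at hinj
    · exact hstar.tensorCoord_comm ((basisNu K).coord 1) ((basisNu K).coord 2) r
  · rintro ⟨d, s, rfl, -, -, hs, h⟩
    refine ⟨isDStarRing_diffDiffStructure h, assocEndosInjective_diffDiffStructure_iff.2 hs,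
      fun r => ?_⟩
    simp [coord_apply, diffDiffStructure_apply, basisNu_repr_zero]

theorem isDHom_diffDiffPoly (ι : Type*) (d : Derivation K R R) (s : R →ₐ[K] R) :
    IsDHom (diffDiffStructure d s)
      (diffDiffStructure (diffDiffPolyDeriv ι d) (diffDiffPolyEndo ι s))
      (IsScalarTower.toAlgHom K R (DiffDiffPoly ι R)) := by
  intro r
  simp [diffDiffStructure_apply, mapD, diffDiffPolyDeriv, diffDiffPolyEndo,
    MvPolynomial.algebraMap_eq]

theorem exists_surjective_diffDiffPoly (ι : Type*) (d : Derivation K R R) (s : R →ₐ[K] R) :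
    ∃ φ : DStarPoly 3 ι R →ₐ[R] DiffDiffPoly ι R,
      IsDHom (polyStructure (basisNu K) ι (diffDiffStructure d s))
        (diffDiffStructure (diffDiffPolyDeriv ι d) (diffDiffPolyEndo ι s))
        (φ.restrictScalars K) ∧
      Function.Surjective φ ∧
      ∀ (i : ι) (θ : Fin 3 → ℕ), φ (MvPolynomial.X (i, θ)) = MvPolynomial.X (i, θ 1, θ 2) := by
  refine ⟨MvPolynomial.rename fun v => (v.1, v.2 1, v.2 2), ?_,
    MvPolynomial.rename_surjective _ fun v => ⟨(v.1, ![0, v.2.1, v.2.2]), rfl⟩, by simp⟩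
  refine isDHom_of_polynomial (fun r => ?_) fun t => ?_
  · simp [diffDiffStructure_apply, mapD, diffDiffPolyDeriv, diffDiffPolyEndo, polyStructure,
      MvPolynomial.algebraMap_eq]
  · simp [diffDiffStructure_apply, mapD, diffDiffPolyDeriv, diffDiffPolyEndo, polyStructure,
      basisNu_zero, basisNu_one, basisNu_two, Fin.sum_univ_three]

theorem diffDiffPolyEndo_eq (ι : Type*) (s : R →ₐ[K] R) :
    diffDiffPolyEndo ι s = extendEndo s fun v => (v.1, v.2.1, v.2.2 + 1) :=
  rfl

theorem diffDiffPoly_comm (ι : Type*) {d : Derivation K R R} {s : R →ₐ[K] R}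
    (h : ∀ r, d (s r) = s (d r)) (p : DiffDiffPoly ι R) :
    diffDiffPolyDeriv ι d (diffDiffPolyEndo ι s p) =
      diffDiffPolyEndo ι s (diffDiffPolyDeriv ι d p) := by
  rw [diffDiffPolyEndo_eq, diffDiffPolyDeriv]
  induction p using MvPolynomial.induction_on with
  | C r => simp [h]
  | add p q hp hq => simp only [map_add, hp, hq]
  | mul_X p t hp => simp [hp]

theorem extendEndo_injective {T : Type*} {s : R →ₐ[K] R} (hs : Function.Injective s) {S : T → T}
    (hS : Function.Injective S) : Function.Injective (extendEndo s S) := by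
  -- The endomorphism is an injective map on coefficients followed by an injective renaming.
  have h : ∀ p, extendEndo s S p = MvPolynomial.rename S (MvPolynomial.map (s : R →+* R) p) := by
    intro p
    induction p using MvPolynomial.induction_on with
    | C r => simp
    | add p q hp hq => simp only [map_add, hp, hq]
    | mul_X p t hp => simp [hp]
  intro p q hpq
  rw [h, h] at hpq
  exact MvPolynomial.map_injective _ hs (MvPolynomial.rename_injective _ hS hpq)

end DifferenceDifferential

/-! ### Dickson's lemma and the two basis theorems. -/

section BasisTheorems

/-- If no finite subset dominated `T`, successive choices would yield an infinite bad sequence. -/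
theorem exists_finset_of_wellQuasiOrdered {α : Type*} {r : α → α → Prop} (hr : WellQuasiOrdered r) (T : Set α) :
    ∃ T₀ : Finset α, (T₀ : Set α) ⊆ T ∧ ∀ t ∈ T, ∃ t₀ ∈ T₀, r t₀ t := by
  by_contra! h
  obtain ⟨f, -, hf⟩ := exists_seq_of_forall_finset_exists (· ∈ T) (fun a b => ¬ r a b)
    fun F hF => (h F hF)
  obtain ⟨m, n, hmn, hr⟩ := hr f
  exact hf m n hmn hr

theorem hasACC_congr {R : Type*} [CommRing R] {P Q : Ideal R → Prop} (h : ∀ I, P I ↔ Q I) :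
    HasACC P ↔ HasACC Q := by
  rw [funext fun I => propext (h I)]

theorem iterate_derivIndex {ι : Type*} (k : ℕ) (v : ι × ℕ) :
    (fun v : ι × ℕ => (v.1, v.2 + 1))^[k] v = (v.1, v.2 + k) := by
  induction k with
  | zero => rfl
  | succ k ih => rw [Function.iterate_succ_apply', ih, add_assoc]

theorem iterate_derivIndex₂ {ι : Type*} (k : ℕ) (v : ι × ℕ × ℕ) :
    (fun v : ι × ℕ × ℕ => (v.1, v.2.1 + 1, v.2.2))^[k] v = (v.1, v.2.1 + k, v.2.2) := by
  induction k with
  | zero => rfl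
  | succ k ih => rw [Function.iterate_succ_apply', ih, add_assoc]

theorem iterate_endoIndex₂ {ι : Type*} (k : ℕ) (v : ι × ℕ × ℕ) :
    (fun v : ι × ℕ × ℕ => (v.1, v.2.1, v.2.2 + 1))^[k] v = (v.1, v.2.1, v.2.2 + k) := by
  induction k with
  | zero => rfl
  | succ k ih => rw [Function.iterate_succ_apply', ih, add_assoc]

variable {K : Type*} [Field K] [CharZero K] {R : Type*} [CommRing R] [Algebra K R]
  (ι : Type*) [Finite ι]

theorem hasACC_diffPoly (d : Derivation K R R) (h : HasACC (IsRadicalDiffIdeal d)) :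
    HasACC (IsRadicalDiffIdeal (diffPolyDeriv ι d)) := by
  obtain ⟨n, ⟨e⟩⟩ := Finite.exists_equiv_fin ι
  -- Comparing the index `i` first gives a well-order for which differentiation is strictly monotone
  -- and increasing.
  let toLex' : ι × ℕ → Fin n ×ₗ ℕ := fun v => toLex (e v.1, v.2)
  have hinj : Function.Injective toLex' := by
    rintro ⟨i, k⟩ ⟨j, l⟩ hv
    simpa [toLex'] using hv
  let _ : LinearOrder (ι × ℕ) := LinearOrder.lift' toLex' hinj
  have hlt : ∀ v w : ι × ℕ, v < w ↔ toLex' v < toLex' w := fun _ _ => Iff.rfl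
  have : WellFoundedLT (ι × ℕ) := ⟨InvImage.wf toLex' wellFounded_lt⟩
  -- Dickson's lemma on (index, order of derivative, degree); equality on the finite set `ι` is a
  -- well-quasi-order.
  have hwqo := (Finite.wellQuasiOrdered (α := ι) (· = ·)).prod
    ((wellQuasiOrdered_le (α := ℕ)).prod (wellQuasiOrdered_le (α := ℕ)))
  have hbasis : ∀ T : Set ((ι × ℕ) × ℕ), ∃ T₀ : Finset ((ι × ℕ) × ℕ),
      (T₀ : Set ((ι × ℕ) × ℕ)) ⊆ T ∧ ∀ t ∈ T, ∃ t₀ ∈ T₀, t₀.2 ≤ t.2 ∧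
        ∃ k l, id^[l] ((fun v : ι × ℕ => (v.1, v.2 + 1))^[k] t₀.1) = t.1 := by
    intro T
    obtain ⟨T₀, hT₀, hT⟩ := exists_finset_of_wellQuasiOrdered
      (r := fun a b : (ι × ℕ) × ℕ => a.1.1 = b.1.1 ∧ a.1.2 ≤ b.1.2 ∧ a.2 ≤ b.2)
      (fun f => hwqo fun m => ((f m).1.1, (f m).1.2, (f m).2)) T
    refine ⟨T₀, hT₀, fun t ht => ?_⟩
    obtain ⟨t₀, ht₀, h1, h2, h3⟩ := hT t ht
    refine ⟨t₀, ht₀, h3, t.1.2 - t₀.1.2, 0, ?_⟩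
    rw [iterate_derivIndex]
    exact Prod.ext h1 (Nat.add_sub_cancel' h2)
  -- This identifies the differential case with the general theorem for `σ = id`.
  have hid : extendEndo (AlgHom.id K R) id = AlgHom.id K (DiffPoly ι R) := by
    refine AlgHom.ext fun p => ?_
    induction p using MvPolynomial.induction_on with
    | C r => simp
    | add p q hp hq => rw [map_add, map_add, hp, hq]
    | mul_X p t hp => rw [map_mul, map_mul, hp]; simp
  rw [hasACC_congr fun _ => isRadicalDiffIdeal_iff] at h ⊢
  rw [← hid]
  refine hasACC_extend (D := fun v : ι × ℕ => (v.1, v.2 + 1)) (S := id) ?_ ?_ strictMono_id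
    hbasis h
  · intro v w hvw
    rw [hlt, Prod.Lex.toLex_lt_toLex] at hvw ⊢
    simpa using hvw
  · intro v
    rw [hlt, Prod.Lex.toLex_lt_toLex]
    simp

theorem hasACC_diffDiffPoly (d : Derivation K R R) (s : R →ₐ[K] R)
    (h : HasACC (IsPerfectDiffDiffIdeal d s)) :
    HasACC (IsPerfectDiffDiffIdeal (diffDiffPolyDeriv ι d) (diffDiffPolyEndo ι s)) := by
  obtain ⟨n, ⟨e⟩⟩ := Finite.exists_equiv_fin ι
  let toLex' : ι × ℕ × ℕ → Fin n ×ₗ ℕ ×ₗ ℕ := fun v => toLex (e v.1, toLex v.2)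
  have hinj : Function.Injective toLex' := by
    rintro ⟨i, k⟩ ⟨j, l⟩ hv
    simpa [toLex'] using hv
  let _ : LinearOrder (ι × ℕ × ℕ) := LinearOrder.lift' toLex' hinj
  have hlt : ∀ v w : ι × ℕ × ℕ, v < w ↔ toLex' v < toLex' w := fun _ _ => Iff.rfl
  have : WellFoundedLT (ι × ℕ × ℕ) := ⟨InvImage.wf toLex' wellFounded_lt⟩
  have hwqo := (Finite.wellQuasiOrdered (α := ι) (· = ·)).prod
    ((wellQuasiOrdered_le (α := ℕ)).prod
      ((wellQuasiOrdered_le (α := ℕ)).prod (wellQuasiOrdered_le (α := ℕ))))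
  have hbasis : ∀ T : Set ((ι × ℕ × ℕ) × ℕ), ∃ T₀ : Finset ((ι × ℕ × ℕ) × ℕ),
      (T₀ : Set ((ι × ℕ × ℕ) × ℕ)) ⊆ T ∧ ∀ t ∈ T, ∃ t₀ ∈ T₀, t₀.2 ≤ t.2 ∧
        ∃ k l, (fun v : ι × ℕ × ℕ => (v.1, v.2.1, v.2.2 + 1))^[l]
          ((fun v : ι × ℕ × ℕ => (v.1, v.2.1 + 1, v.2.2))^[k] t₀.1) = t.1 := by
    intro T
    obtain ⟨T₀, hT₀, hT⟩ := exists_finset_of_wellQuasiOrdered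
      (r := fun a b : (ι × ℕ × ℕ) × ℕ =>
        a.1.1 = b.1.1 ∧ a.1.2.1 ≤ b.1.2.1 ∧ a.1.2.2 ≤ b.1.2.2 ∧ a.2 ≤ b.2)
      (fun f => hwqo fun m => ((f m).1.1, (f m).1.2.1, (f m).1.2.2, (f m).2)) T
    refine ⟨T₀, hT₀, fun t ht => ?_⟩
    obtain ⟨t₀, ht₀, h1, h2, h3, h4⟩ := hT t ht
    refine ⟨t₀, ht₀, h4, t.1.2.1 - t₀.1.2.1, t.1.2.2 - t₀.1.2.2, ?_⟩
    rw [iterate_derivIndex₂, iterate_endoIndex₂]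
    exact Prod.ext h1 (Prod.ext (Nat.add_sub_cancel' h2) (Nat.add_sub_cancel' h3))
  rw [hasACC_congr fun _ => isPerfectDiffDiffIdeal_iff] at h ⊢
  refine hasACC_extend (D := fun v : ι × ℕ × ℕ => (v.1, v.2.1 + 1, v.2.2))
    (S := fun v : ι × ℕ × ℕ => (v.1, v.2.1, v.2.2 + 1)) ?_ ?_ ?_ hbasis h
  · intro v w hvw
    rw [hlt, Prod.Lex.toLex_lt_toLex, Prod.Lex.toLex_lt_toLex] at hvw ⊢
    simpa using hvw
  · intro v
    rw [hlt, Prod.Lex.toLex_lt_toLex, Prod.Lex.toLex_lt_toLex]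
    simp
  · intro v w hvw
    rw [hlt, Prod.Lex.toLex_lt_toLex, Prod.Lex.toLex_lt_toLex] at hvw ⊢
    simpa using hvw

end BasisTheorems

end DRing

end

theorem mainTheorem3 (K : Type*) [Field K] [CharZero K]
    (R : Type*) [CommRing R] [Algebra K R] (ι : Type*) [Finite ι] :
    -- the differential case: `D = K[ε]/(ε)^2`, with coordinate maps `σ, δ`
    ((∀ e : R →ₐ[K] R ⊗[K] K[ε],
        (DRing.IsDStarRing e ∧ ∀ r, DRing.coord (DRing.basisEps K) e 0 r = r) ↔
          ∃ d : Derivation K R R,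
            e = DRing.diffStructure d ∧ ∀ r, DRing.coord (DRing.basisEps K) e 1 r = d r) ∧
      ∀ d : Derivation K R R,
        -- `R{x}_δ` is a `D*`-algebra over `(R, e)` and a quotient of `R{x}_{D*}`
        DRing.IsDStarRing (DRing.diffStructure (DRing.diffPolyDeriv ι d)) ∧
        DRing.AssocEndosInjective (DRing.diffStructure (DRing.diffPolyDeriv ι d)) ∧
        DRing.IsDHom (DRing.diffStructure d) (DRing.diffStructure (DRing.diffPolyDeriv ι d))
          (IsScalarTower.toAlgHom K R (DRing.DiffPoly ι R)) ∧
        (∃ φ : DRing.DStarPoly 2 ι R →ₐ[R] DRing.DiffPoly ι R,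
          DRing.IsDHom (DRing.polyStructure (DRing.basisEps K) ι (DRing.diffStructure d))
            (DRing.diffStructure (DRing.diffPolyDeriv ι d)) (φ.restrictScalars K) ∧
          Function.Surjective φ ∧
          ∀ (i : ι) (θ : Fin 2 → ℕ), φ (MvPolynomial.X (i, θ)) = MvPolynomial.X (i, θ 1)) ∧
        -- perfect `D`-ideals are the radical differential ideals
        (∀ I : Ideal R, DRing.IsPerfectDIdeal (DRing.diffStructure d) I ↔
          DRing.IsRadicalDiffIdeal d I) ∧
        (∀ I : Ideal (DRing.DiffPoly ι R),
          DRing.IsPerfectDIdeal (DRing.diffStructure (DRing.diffPolyDeriv ι d)) I ↔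
            DRing.IsRadicalDiffIdeal (DRing.diffPolyDeriv ι d) I) ∧
        -- the differential basis theorem
        (DRing.HasACC (DRing.IsPerfectDIdeal (DRing.diffStructure d)) →
          DRing.HasACC
            (DRing.IsPerfectDIdeal (DRing.diffStructure (DRing.diffPolyDeriv ι d)))) ∧
        (DRing.HasACC (DRing.IsRadicalDiffIdeal d) →
          DRing.HasACC (DRing.IsRadicalDiffIdeal (DRing.diffPolyDeriv ι d)))) ∧
    -- the difference-differential case: `D = K[ν]/(ν)^2 × K`, with coordinate maps `σ_0, δ, σ`
    ((∀ e : R →ₐ[K] R ⊗[K] (K[ε] × K),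
        (DRing.IsDStarRing e ∧ DRing.AssocEndosInjective e ∧
          ∀ r, DRing.coord (DRing.basisNu K) e 0 r = r) ↔
          ∃ (d : Derivation K R R) (s : R →ₐ[K] R),
            e = DRing.diffDiffStructure d s ∧
            (∀ r, DRing.coord (DRing.basisNu K) e 1 r = d r) ∧
            (∀ r, DRing.coord (DRing.basisNu K) e 2 r = s r) ∧
            Function.Injective s ∧ ∀ r, d (s r) = s (d r)) ∧
      ∀ (d : Derivation K R R) (s : R →ₐ[K] R), Function.Injective s → (∀ r, d (s r) = s (d r)) →
        -- `R{x}_{σ,δ}` is a `D*`-algebra over `(R, e)` and a quotient of `R{x}_{D*}`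
        DRing.IsDStarRing (DRing.diffDiffStructure (DRing.diffDiffPolyDeriv ι d)
          (DRing.diffDiffPolyEndo ι s)) ∧
        DRing.AssocEndosInjective (DRing.diffDiffStructure (DRing.diffDiffPolyDeriv ι d)
          (DRing.diffDiffPolyEndo ι s)) ∧
        DRing.IsDHom (DRing.diffDiffStructure d s)
          (DRing.diffDiffStructure (DRing.diffDiffPolyDeriv ι d) (DRing.diffDiffPolyEndo ι s))
          (IsScalarTower.toAlgHom K R (DRing.DiffDiffPoly ι R)) ∧
        (∃ φ : DRing.DStarPoly 3 ι R →ₐ[R] DRing.DiffDiffPoly ι R,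
          DRing.IsDHom (DRing.polyStructure (DRing.basisNu K) ι (DRing.diffDiffStructure d s))
            (DRing.diffDiffStructure (DRing.diffDiffPolyDeriv ι d) (DRing.diffDiffPolyEndo ι s))
            (φ.restrictScalars K) ∧
          Function.Surjective φ ∧
          ∀ (i : ι) (θ : Fin 3 → ℕ),
            φ (MvPolynomial.X (i, θ)) = MvPolynomial.X (i, θ 1, θ 2)) ∧
        -- perfect `D`-ideals are the perfect difference-differential ideals
        (∀ I : Ideal R, DRing.IsPerfectDIdeal (DRing.diffDiffStructure d s) I ↔
          DRing.IsPerfectDiffDiffIdeal d s I) ∧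
        (∀ I : Ideal (DRing.DiffDiffPoly ι R),
          DRing.IsPerfectDIdeal (DRing.diffDiffStructure (DRing.diffDiffPolyDeriv ι d)
            (DRing.diffDiffPolyEndo ι s)) I ↔
            DRing.IsPerfectDiffDiffIdeal (DRing.diffDiffPolyDeriv ι d)
              (DRing.diffDiffPolyEndo ι s) I) ∧
        -- the difference-differential basis theorem
        (DRing.HasACC (DRing.IsPerfectDIdeal (DRing.diffDiffStructure d s)) →
          DRing.HasACC (DRing.IsPerfectDIdeal (DRing.diffDiffStructure
            (DRing.diffDiffPolyDeriv ι d) (DRing.diffDiffPolyEndo ι s)))) ∧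
        (DRing.HasACC (DRing.IsPerfectDiffDiffIdeal d s) →
          DRing.HasACC (DRing.IsPerfectDiffDiffIdeal (DRing.diffDiffPolyDeriv ι d)
            (DRing.diffDiffPolyEndo ι s)))) := by

  refine ⟨⟨DRing.exists_derivation_iff, fun d => ?_⟩,
    ⟨DRing.exists_derivation_endo_iff, fun d s hs hds => ?_⟩⟩
  · refine ⟨DRing.isDStarRing_diffStructure _, DRing.assocEndosInjective_diffStructure _,
      DRing.isDHom_diffPoly ι d, DRing.exists_surjective_diffPoly ι d,
      DRing.isPerfectDIdeal_diffStructure_iff d, DRing.isPerfectDIdeal_diffStructure_iff _,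
      fun h => ?_, DRing.hasACC_diffPoly ι d⟩
    rw [DRing.hasACC_congr (DRing.isPerfectDIdeal_diffStructure_iff _)] at h ⊢
    exact DRing.hasACC_diffPoly ι d h
  · refine ⟨DRing.isDStarRing_diffDiffStructure (DRing.diffDiffPoly_comm ι hds),
      DRing.assocEndosInjective_diffDiffStructure_iff.2 (DRing.extendEndo_injective hs ?_),
      DRing.isDHom_diffDiffPoly ι d s, DRing.exists_surjective_diffDiffPoly ι d s,
      DRing.isPerfectDIdeal_diffDiffStructure_iff d s,
      DRing.isPerfectDIdeal_diffDiffStructure_iff _ _, fun h => ?_,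
      DRing.hasACC_diffDiffPoly ι d s⟩
    · rintro ⟨i, k, l⟩ ⟨j, k', l'⟩ h
      simpa using h
    · rw [DRing.hasACC_congr (DRing.isPerfectDIdeal_diffDiffStructure_iff _ _)] at h ⊢
      exact DRing.hasACC_diffDiffPoly ι d s h
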